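/- For vectors $u,v\in\mathbb{R}^d$ the segment $\ell$ given by $(u,v)$ is the function $\ell(x)=u+xv$ on $[0,1]$. For a nonempty finite set $P\subset\mathbb{R}^d$ and a family $L=(\ell_1,\dots,\ell_n)$ of segments let $$\mathrm{loss}(P,L)=\sum_{i=1}^{n}\int_0^1\min_{c\in P}\|c-\ell_i(x)\|_2^2\,dx$$ be the $k$-means loss. There are a randomized algorithm (a single program for a real RAM with unit-cost exact real arithmetic and comparisons, indirect addressing, and independent uniform random numbers from $[0,1]$) and universal constants $A,B$ such that the following holds for all integers $d,n,k\ge 1$, every family $L$ of $n$ segments in $\mathbb{R}^d$ and all $\varepsilon,\delta\in(0,1/10]$. On input $(d,n,k,L,\varepsilon,\delta)$ the algorithm always halts within $$A\cdot\frac{d\,n\,k^3}{\varepsilon}\,\log_2(1/\delta)$$ steps and outputs a set $P\subset\mathbb{R}^d$ with $|P|=k$, and with probability at least $1-\delta$ $$\mathrm{loss}(P,L)\le B\,(1+\log_2 k)\min_{P'\subset\mathbb{R}^d,\ |P'|=k}\mathrm{loss}(P',L).$$ -/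

import Mathlib

open MeasureTheory

noncomputable section

namespace SegClust

/-! ### Segments and the loss -/

/-- A segment in `ℝ^d`, given by the two vectors `u, v` of the function `x ↦ u + x v` on `[0,1]`.
(The pair is determined by the function.) -/
structure Segment (d : ℕ) where
  u : EuclideanSpace ℝ (Fin d)
  v : EuclideanSpace ℝ (Fin d)

/-- The point `ℓ(x) = u + x v` of the segment. -/
def Segment.point {d : ℕ} (l : Segment d) (x : ℝ) : EuclideanSpace ℝ (Fin d) :=
  l.u + x • l.v

/-- `D((C,w),p) = min_{c ∈ C} lip (w(c) ‖c - p‖)` for a nonempty finite weighted set `(C,w)`. -/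
def weightedDist {d : ℕ} (lip : ℝ → ℝ) (C : Finset (EuclideanSpace ℝ (Fin d)))
    (w : EuclideanSpace ℝ (Fin d) → ℝ) (p : EuclideanSpace ℝ (Fin d)) : ℝ :=
  ⨅ c : C, lip (w c * dist (c : EuclideanSpace ℝ (Fin d)) p)

/-- The fitting loss of `(C,w)` to a finite family of segments,
`∑_ℓ ∫_0^1 D((C,w),ℓ(x)) dx`. -/
def weightedLoss {d n : ℕ} (lip : ℝ → ℝ) (C : Finset (EuclideanSpace ℝ (Fin d)))
    (w : EuclideanSpace ℝ (Fin d) → ℝ) (L : Fin n → Segment d) : ℝ :=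
  ∑ i, ∫ x in (0 : ℝ)..1, weightedDist lip C w ((L i).point x)

/-- The `k`-means loss: `lip(x) = x²` and all centers have weight one. -/
def loss {d n : ℕ} (P : Finset (EuclideanSpace ℝ (Fin d))) (L : Fin n → Segment d) : ℝ :=
  weightedLoss (fun x => x ^ 2) P (fun _ => 1) L

/-! ### A randomized real RAM with unit costs

The machine has registers and arrays of natural numbers (for counting and indirect addressing),
registers and arrays of exact real numbers, and a source of independent uniform random numbers in
`[0,1]`. Registers and arrays are named by literals of the program, cells of an array are addressed
by a register. Programs contain integer constants only. -/

/-- The random source: the sequence of all numbers that it can deliver. -/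
abbrev Tape : Type := ℕ → unitInterval

/-- Independent uniform random numbers. -/
def tapeMeasure : Measure Tape :=
  Measure.infinitePi fun _ : ℕ => (volume : Measure unitInterval)

/-- A memory state. -/
structure State where
  /-- registers for natural numbers -/
  natReg : ℕ → ℕ
  /-- arrays of natural numbers: array name, index -/
  natArr : ℕ → ℕ → ℕ
  /-- registers for real numbers -/
  realReg : ℕ → ℝ
  /-- arrays of real numbers: array name, index -/
  realArr : ℕ → ℕ → ℝ
  /-- how many random numbers have been used -/
  used : ℕ

/-- Overwrite a natural register. -/
def State.setNat (s : State) (i x : ℕ) : State :=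
  { s with natReg := Function.update s.natReg i x }

/-- Overwrite a real register. -/
def State.setReal (s : State) (i : ℕ) (x : ℝ) : State :=
  { s with realReg := Function.update s.realReg i x }

/-- The elementary instructions. -/
inductive Instr where
  /-- `N i := c` -/
  | natConst (i c : ℕ)
  /-- `N i := N j + N l` -/
  | natAdd (i j l : ℕ)
  /-- `N i := max (N j - N l) 0` -/
  | natSub (i j l : ℕ)
  /-- `N i := A_a [N j]` -/
  | natLoad (i a j : ℕ)
  /-- `A_a [N j] := N i` -/
  | natStore (a j i : ℕ)
  /-- `R i := c` -/
  | realConst (i : ℕ) (c : ℤ)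
  /-- `R i := N j` -/
  | realOfNat (i j : ℕ)
  /-- `R i := R j + R l` -/
  | realAdd (i j l : ℕ)
  /-- `R i := R j - R l` -/
  | realSub (i j l : ℕ)
  /-- `R i := R j * R l` -/
  | realMul (i j l : ℕ)
  /-- `R i := R j / R l` (zero if `R l = 0`) -/
  | realDiv (i j l : ℕ)
  /-- `R i := B_a [N j]` -/
  | realLoad (i a j : ℕ)
  /-- `B_a [N j] := R i` -/
  | realStore (a j i : ℕ)
  /-- `R i :=` the next random number -/
  | random (i : ℕ)

/-- The effect of an elementary instruction. -/
def Instr.exec (ω : Tape) (s : State) : Instr → State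
  | .natConst i c => s.setNat i c
  | .natAdd i j l => s.setNat i (s.natReg j + s.natReg l)
  | .natSub i j l => s.setNat i (s.natReg j - s.natReg l)
  | .natLoad i a j => s.setNat i (s.natArr a (s.natReg j))
  | .natStore a j i =>
      { s with natArr := Function.update s.natArr a
                (Function.update (s.natArr a) (s.natReg j) (s.natReg i)) }
  | .realConst i c => s.setReal i (c : ℝ)
  | .realOfNat i j => s.setReal i (s.natReg j : ℝ)
  | .realAdd i j l => s.setReal i (s.realReg j + s.realReg l)
  | .realSub i j l => s.setReal i (s.realReg j - s.realReg l)
  | .realMul i j l => s.setReal i (s.realReg j * s.realReg l)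
  | .realDiv i j l => s.setReal i (s.realReg j / s.realReg l)
  | .realLoad i a j => s.setReal i (s.realArr a (s.natReg j))
  | .realStore a j i =>
      { s with realArr := Function.update s.realArr a
                (Function.update (s.realArr a) (s.natReg j) (s.realReg i)) }
  | .random i => { s.setReal i (ω s.used : ℝ) with used := s.used + 1 }

/-- The elementary tests. -/
inductive Test where
  /-- `N i < N j` -/
  | natLt (i j : ℕ)
  /-- `R i < R j` -/
  | realLt (i j : ℕ)

/-- The outcome of a test. -/
def Test.Holds (s : State) : Test → Prop
  | .natLt i j => s.natReg i < s.natReg j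
  | .realLt i j => s.realReg i < s.realReg j

/-- Programs. -/
inductive Program where
  | instr (a : Instr)
  | seq (p q : Program)
  | ite (b : Test) (p q : Program)
  | loop (b : Test) (p : Program)

open Classical in
/-- One step of the machine. A configuration is the list of the program parts that are still to be
executed, together with the memory; the machine has halted when the list is empty. Every elementary
instruction, every test and every sequencing costs one step. -/
def step (ω : Tape) : List Program × State → List Program × State
  | ([], s) => ([], s)
  | (.instr a :: K, s) => (K, a.exec ω s)
  | (.seq p q :: K, s) => (p :: q :: K, s)
  | (.ite b p q :: K, s) => ((if b.Holds s then p else q) :: K, s)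
  | (.loop b p :: K, s) => (if b.Holds s then p :: .loop b p :: K else K, s)

/-- Started in memory state `s`, the program halts within `t` steps, in memory state `s'`. -/
def HaltsWithin (ω : Tape) (p : Program) (s : State) (t : ℕ) (s' : State) : Prop :=
  (step ω)^[t] ([p], s) = ([], s')

/-- Read a vector as a sequence of coordinates, padded by zeros. -/
def coords {d : ℕ} (x : EuclideanSpace ℝ (Fin d)) (j : ℕ) : ℝ :=
  if h : j < d then x ⟨j, h⟩ else 0

/-- A finite sequence of vectors as one array: coordinate `j` of vector `i` is in cell `i d + j`. -/
def flatten {d n : ℕ} (x : Fin n → EuclideanSpace ℝ (Fin d)) (m : ℕ) : ℝ :=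
  if h : m / d < n then coords (x ⟨m / d, h⟩) (m % d) else 0

/-- The initial memory: `d, n, k` in the natural registers `0, 1, 2`, `ε, δ` in the real registers
`0, 1`, the vectors `u` of the segments in the real array `0` and the vectors `v` in the real
array `1`; everything else is zero. -/
def inputState {d n : ℕ} (k : ℕ) (L : Fin n → Segment d) (ε δ : ℝ) : State where
  natReg := fun i => if i = 0 then d else if i = 1 then n else if i = 2 then k else 0
  natArr := fun _ _ => 0
  realReg := fun i => if i = 0 then ε else if i = 1 then δ else 0
  realArr := fun a => if a = 0 then flatten fun i => (L i).u
    else if a = 1 then flatten fun i => (L i).v else fun _ => 0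
  used := 0

open Classical in
/-- The output: the set of the `k` points whose coordinates are in the real array `2`, coordinate
`j` of point `i` in cell `i d + j`. -/
def outputPoints (d k : ℕ) (s : State) : Finset (EuclideanSpace ℝ (Fin d)) :=
  Finset.univ.image fun i : Fin k =>
    WithLp.toLp 2 fun j : Fin d => s.realArr 2 ((i : ℕ) * d + j)

end SegClust

end

/-! The proof replaces every segment by 2k equally spaced points and runs `D²`-sampling (k-means++)
on the resulting N = 2kn points.

The discretisation costs only a constant factor for every set P of at most k centres. Neighbouring
grid points are ‖v‖/(2k) apart, so each centre is closer than half that distance to at most one of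
them, and at least k of the 2k points are far from P (`le_sum_grid`). The grid sum therefore
dominates the error made by sliding the grid by one spacing. Since the integral over the segment is
an integral of slid grid sums, the grid sum and 2k times the integral agree up to the factor 18
(`integral_grid_bounds`). The grid does not depend on ε.

On the grid points, fix an assignment to k clusters. A round of sampling hits a cluster A with
probability proportional to its current cost; when it hits an unhit A, the new cost of A is on
average at most four times `spread` (`sum_sq_sampling_le`). The danger is a round wasted on a
cluster already hit. With m rounds to go and u unhit clusters, `potential` charges the hit cost plus
four times the unhit spread with the factor 1 + H_m, and the unhit cost with the factor (u - m)/u.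
The loss from a wasted round is paid for by the drop from H_{m+1} to H_m, so the potential is a
supermartingale (`sum_mul_potential_le`). It starts at no more than 4(1 + H_{k-1}) times the total
spread on average and ends above the cost. For an assignment of minimal spread, that total is at
most four times the cost of any k centres (`exists_assignment_spread_le`).

By Markov's inequality one run exceeds twice this bound with probability at most 1/2. Runs on
disjoint parts of the tape are independent, so the best of about log₂(1/δ) runs fails with
probability at most δ (`measure_all_trials_le`). The centres are always distinct, because a sampled
point has positive distance from the earlier ones and otherwise a fallback point outside the list is
used.

The program is verified by a Hoare logic with step bounds. Its specifications identify the memory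
with the mathematical seeding for every tape (`clusterProg_spec`); probability enters only
afterwards. -/

noncomputable section

namespace SegClust

/-! ### Squared distance to a finite set -/

section SqDist

variable {E : Type*} [PseudoMetricSpace E]

/-- The squared distance of a point to a finite set. -/
def sqDist (P : Finset E) (p : E) : ℝ := ⨅ c : P, dist (c : E) p ^ 2

lemma sqDist_nonneg (P : Finset E) (p : E) : 0 ≤ sqDist P p :=
  Real.iInf_nonneg fun _ => sq_nonneg _

lemma sqDist_le {P : Finset E} {c : E} (hc : c ∈ P) (p : E) : sqDist P p ≤ dist c p ^ 2 :=
  ciInf_le (f := fun c : P => dist (c : E) p ^ 2) (Set.finite_range _).bddBelow ⟨c, hc⟩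

lemma exists_sqDist_eq {P : Finset E} (hP : P.Nonempty) (p : E) :
    ∃ c ∈ P, sqDist P p = dist c p ^ 2 := by
  have : Nonempty P := hP.to_subtype
  obtain ⟨c, hc⟩ := exists_eq_ciInf_of_finite (f := fun c : P => dist (c : E) p ^ 2)
  exact ⟨c, c.2, hc.symm⟩

lemma sqDist_singleton (c p : E) : sqDist {c} p = dist c p ^ 2 := by
  obtain ⟨c', hc', h⟩ := exists_sqDist_eq (Finset.singleton_nonempty c) p
  rw [h, Finset.mem_singleton.1 hc']

lemma sqDist_insert [DecidableEq E] {P : Finset E} (hP : P.Nonempty) (c p : E) :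
    sqDist (insert c P) p = min (sqDist P p) (dist c p ^ 2) := by
  apply le_antisymm
  · obtain ⟨c', hc', h⟩ := exists_sqDist_eq hP p
    refine le_min ?_ (sqDist_le (Finset.mem_insert_self _ _) p)
    rw [h]
    exact sqDist_le (Finset.mem_insert_of_mem hc') p
  · obtain ⟨c', hc', h⟩ := exists_sqDist_eq (Finset.insert_nonempty c P) p
    rw [h]
    rcases Finset.mem_insert.1 hc' with rfl | h'
    · exact min_le_right _ _
    · exact (min_le_left _ _).trans (sqDist_le h' p)

lemma notMem_of_sqDist_pos {P : Finset E} {p : E} (h : 0 < sqDist P p) : p ∉ P := fun hp => by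
  have := sqDist_le hp p
  simp at this
  linarith

lemma continuous_sqDist {P : Finset E} (hP : P.Nonempty) : Continuous (sqDist P) := by
  have : Nonempty P := hP.to_subtype
  have : sqDist P = fun p => Finset.univ.inf' Finset.univ_nonempty
      (fun c : P => dist (c : E) p ^ 2) := by
    funext p
    rw [Finset.inf'_univ_eq_ciInf]
    rfl
  rw [this]
  exact Continuous.finset_inf'_apply _ fun c _ => by fun_prop

lemma dist_sq_le_two_mul (a b c : E) : dist a c ^ 2 ≤ 2 * dist a b ^ 2 + 2 * dist b c ^ 2 := by
  have h := dist_triangle a b c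
  nlinarith [sq_nonneg (dist a b - dist b c), dist_nonneg (x := a) (y := c),
    dist_nonneg (x := a) (y := b), dist_nonneg (x := b) (y := c)]

lemma sqDist_le_two_mul {P : Finset E} (hP : P.Nonempty) (p q : E) :
    sqDist P p ≤ 2 * sqDist P q + 2 * dist q p ^ 2 := by
  obtain ⟨c, hc, h⟩ := exists_sqDist_eq hP q
  rw [h]
  exact (sqDist_le hc p).trans (dist_sq_le_two_mul c q p)

end SqDist

/-! ### Replacing a segment by a grid -/

section Grid

variable {d : ℕ}

lemma Segment.dist_point (l : Segment d) (x y : ℝ) :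
    dist (l.point x) (l.point y) = |x - y| * ‖l.v‖ := by
  rw [Segment.point, Segment.point, dist_add_left, dist_eq_norm, ← sub_smul, norm_smul,
    Real.norm_eq_abs]

lemma Segment.continuous_point (l : Segment d) : Continuous l.point := by
  unfold Segment.point
  fun_prop

/-- Pigeonhole: with θ = ‖v‖/(4k), two grid points are at least 2θ apart, so no centre lies within
less than θ of both. Hence at most k of the 2k points are near P, and each of the others contributes
at least θ². -/
lemma le_sum_grid {k : ℕ} (hk : 1 ≤ k) (l : Segment d) {P : Finset (EuclideanSpace ℝ (Fin d))}
    (hP : P.Nonempty) (hPk : P.card ≤ k) (y : ℝ) :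
    k * (‖l.v‖ / (4 * k)) ^ 2 ≤
      ∑ s ∈ Finset.range (2 * k), sqDist P (l.point (s / (2 * k : ℕ) + y)) := by
  have hk0 : (0 : ℝ) < k := by exact_mod_cast hk
  set f : ℕ → ℝ := fun s => sqDist P (l.point (s / (2 * k : ℕ) + y)) with hf
  set θ := ‖l.v‖ / (4 * k) with hθ
  have hθ0 : 0 ≤ θ := by positivity
  classical
  set near := (Finset.range (2 * k)).filter fun s => f s < θ ^ 2 with hnear
  set far := (Finset.range (2 * k)).filter fun s => ¬ f s < θ ^ 2 with hfar
  have hcard : near.card + far.card = 2 * k := by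
    rw [hnear, hfar, Finset.card_filter_add_card_filter_not, Finset.card_range]
  choose g hgP hg using fun s : ℕ => exists_sqDist_eq hP (l.point (s / (2 * k : ℕ) + y))
  have hn : near.card ≤ P.card := by
    refine Finset.card_le_card_of_injOn g (fun s _ => hgP s) ?_
    intro s hs t ht hst
    by_contra hne
    have h1 : dist (g s) (l.point (s / (2 * k : ℕ) + y)) < θ := by
      have := (Finset.mem_filter.1 hs).2
      rw [hf] at this
      simp only at this
      rw [hg s] at this
      exact lt_of_pow_lt_pow_left₀ 2 hθ0 this
    have h2 : dist (g s) (l.point (t / (2 * k : ℕ) + y)) < θ := by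
      have := (Finset.mem_filter.1 ht).2
      rw [hf] at this
      simp only at this
      rw [hg t] at this
      rw [hst]
      exact lt_of_pow_lt_pow_left₀ 2 hθ0 this
    have h3 := dist_triangle_left (l.point (s / (2 * k : ℕ) + y)) (l.point (t / (2 * k : ℕ) + y))
      (g s)
    rw [l.dist_point] at h3
    have h4 : (1 : ℝ) ≤ |(s : ℝ) - t| := by
      have : (1 : ℤ) ≤ |(s : ℤ) - t| := Int.one_le_abs (by omega)
      exact_mod_cast this
    have h5 : (s : ℝ) / (2 * k : ℕ) + y - (t / (2 * k : ℕ) + y) = (s - t) / (2 * k) := by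
      push_cast; ring
    rw [h5, abs_div, abs_of_pos (by positivity : (0 : ℝ) < 2 * k)] at h3
    have h6 : 2 * θ ≤ |(s : ℝ) - t| / (2 * k) * ‖l.v‖ := by
      have : 2 * θ = 1 / (2 * k) * ‖l.v‖ := by rw [hθ]; field_simp; ring
      rw [this]
      gcongr
    linarith
  have hfk : k ≤ far.card := by omega
  calc (k : ℝ) * θ ^ 2 ≤ far.card * θ ^ 2 := by gcongr
    _ = ∑ s ∈ far, θ ^ 2 := by simp
    _ ≤ ∑ s ∈ far, f s := Finset.sum_le_sum fun s hs => not_lt.1 (Finset.mem_filter.1 hs).2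
    _ ≤ ∑ s ∈ Finset.range (2 * k), f s :=
      Finset.sum_le_sum_of_subset_of_nonneg (Finset.filter_subset _ _)
        fun s _ _ => sqDist_nonneg _ _

/-- Sliding moves each point by at most 2θ with θ = ‖v‖/(4k), which adds at most 2(2θ)² = 8θ² per
point, or 16kθ² in all. By `le_sum_grid` this is at most 16 times the grid sum at y'; the triangle
inequality contributes the remaining 2 of 18. -/
lemma sum_grid_le {k : ℕ} (hk : 1 ≤ k) (l : Segment d) {P : Finset (EuclideanSpace ℝ (Fin d))}
    (hP : P.Nonempty) (hPk : P.card ≤ k) {y y' : ℝ} (hy : |y' - y| ≤ 1 / (2 * k : ℕ)) :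
    ∑ s ∈ Finset.range (2 * k), sqDist P (l.point (s / (2 * k : ℕ) + y)) ≤
      18 * ∑ s ∈ Finset.range (2 * k), sqDist P (l.point (s / (2 * k : ℕ) + y')) := by
  have hk0 : (0 : ℝ) < k := by exact_mod_cast hk
  have h1 := le_sum_grid hk l hP hPk y'
  have h2 : ∑ s ∈ Finset.range (2 * k), sqDist P (l.point (s / (2 * k : ℕ) + y)) ≤
      ∑ s ∈ Finset.range (2 * k), (2 * sqDist P (l.point (s / (2 * k : ℕ) + y')) +
        8 * (‖l.v‖ / (4 * k)) ^ 2) := by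
    refine Finset.sum_le_sum fun s _ => (sqDist_le_two_mul hP _ (l.point (s / (2 * k : ℕ) + y'))).trans ?_
    rw [l.dist_point]
    have h3 : |(s : ℝ) / (2 * k : ℕ) + y' - (s / (2 * k : ℕ) + y)| ≤ 1 / (2 * k : ℕ) := by
      rwa [add_sub_add_left_eq_sub]
    have h4 : (|(s : ℝ) / (2 * k : ℕ) + y' - (s / (2 * k : ℕ) + y)| * ‖l.v‖) ^ 2 ≤
        (1 / (2 * k : ℕ) * ‖l.v‖) ^ 2 := by gcongr
    have h5 : (1 / ((2 * k : ℕ) : ℝ) * ‖l.v‖) ^ 2 = 4 * (‖l.v‖ / (4 * k)) ^ 2 := by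
      push_cast; field_simp; ring
    linarith
  rw [Finset.sum_add_distrib, ← Finset.mul_sum] at h2
  simp only [Finset.sum_const, Finset.card_range, nsmul_eq_mul] at h2
  push_cast at h1 h2 ⊢
  linarith

/-- Cut [0,1] into M equal intervals and superpose them. -/
lemma integral_eq_integral_sum_grid {M : ℕ} (hM : 1 ≤ M) {f : ℝ → ℝ} (hf : Continuous f) :
    ∫ x in (0 : ℝ)..1, f x =
      ∫ y in (0 : ℝ)..(1 / M), ∑ s ∈ Finset.range M, f (s / M + y) := by
  have hM0 : (0 : ℝ) < M := by exact_mod_cast hM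
  rw [intervalIntegral.integral_finsetSum fun (s : ℕ) _ =>
    (by fun_prop : Continuous fun y : ℝ => f (s / M + y)).intervalIntegrable _ _]
  have h := intervalIntegral.sum_integral_adjacent_intervals (f := f) (μ := volume) (n := M)
    (a := fun s => (s : ℝ) / M) fun s _ => hf.intervalIntegrable _ _
  simp only [Nat.cast_zero, zero_div, div_self hM0.ne'] at h
  rw [← h]
  refine Finset.sum_congr rfl fun s _ => ?_
  rw [intervalIntegral.integral_comp_add_left]
  congr 1
  · simp
  · push_cast; ring

/-- The sum of squared distances over the grid points of all segments. -/
def gridLoss {n : ℕ} (k : ℕ) (P : Finset (EuclideanSpace ℝ (Fin d))) (L : Fin n → Segment d) : ℝ :=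
  ∑ i, ∑ s ∈ Finset.range (2 * k), sqDist P ((L i).point (s / (2 * k : ℕ)))

lemma loss_eq {n : ℕ} (P : Finset (EuclideanSpace ℝ (Fin d))) (L : Fin n → Segment d) :
    loss P L = ∑ i, ∫ x in (0 : ℝ)..1, sqDist P ((L i).point x) := by
  simp only [loss, weightedLoss, weightedDist, sqDist, one_mul]

/-- The offset y runs over an interval whose length is one spacing, so `sum_grid_le` compares every
slid grid with the one at offset 0, in both directions. -/
lemma integral_grid_bounds {k : ℕ} (hk : 1 ≤ k) (l : Segment d)
    {P : Finset (EuclideanSpace ℝ (Fin d))} (hP : P.Nonempty) (hPk : P.card ≤ k) :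
    (2 * k : ℕ) * ∫ x in (0 : ℝ)..1, sqDist P (l.point x) ≤
        18 * ∑ s ∈ Finset.range (2 * k), sqDist P (l.point (s / (2 * k : ℕ))) ∧
      ∑ s ∈ Finset.range (2 * k), sqDist P (l.point (s / (2 * k : ℕ))) ≤
        18 * ((2 * k : ℕ) * ∫ x in (0 : ℝ)..1, sqDist P (l.point x)) := by
  have hM : 1 ≤ 2 * k := by omega
  have hM0 : (0 : ℝ) < (2 * k : ℕ) := by exact_mod_cast hM
  have hM1 : (0 : ℝ) ≤ 1 / (2 * k : ℕ) := by positivity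
  have hc : Continuous fun x => sqDist P (l.point x) :=
    (continuous_sqDist hP).comp l.continuous_point
  have hcs : Continuous fun y : ℝ =>
      ∑ s ∈ Finset.range (2 * k), sqDist P (l.point (s / (2 * k : ℕ) + y)) :=
    continuous_finsetSum _ fun s _ => hc.comp (continuous_const.add continuous_id)
  rw [integral_eq_integral_sum_grid hM hc]
  set S := ∑ s ∈ Finset.range (2 * k), sqDist P (l.point (s / (2 * k : ℕ))) with hS
  have hS' : S = ∑ s ∈ Finset.range (2 * k), sqDist P (l.point (s / (2 * k : ℕ) + 0)) := by
    simp [hS]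
  have hconst : ∀ c : ℝ, ∫ _ in (0 : ℝ)..(1 / (2 * k : ℕ)), c = c / (2 * k : ℕ) := by
    intro c
    simp [div_eq_inv_mul]
  constructor
  · have := intervalIntegral.integral_mono_on (μ := volume) hM1 (hcs.intervalIntegrable _ _)
      (continuous_const (y := 18 * S) |>.intervalIntegrable _ _) fun y hy => by
        rw [hS']
        exact sum_grid_le hk l hP hPk (by rw [zero_sub, abs_neg, abs_of_nonneg hy.1]; exact hy.2)
    rw [hconst, le_div_iff₀ hM0] at this
    linarith
  · have := intervalIntegral.integral_mono_on (μ := volume) hM1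
      (continuous_const (y := S / 18) |>.intervalIntegrable _ _) (hcs.intervalIntegrable _ _)
      fun y hy => by
        have := sum_grid_le hk l hP hPk (y := 0) (y' := y)
          (by rw [sub_zero, abs_of_nonneg hy.1]; exact hy.2)
        rw [← hS'] at this
        linarith
    rw [hconst, div_le_iff₀ hM0] at this
    linarith

lemma loss_le_gridLoss {n k : ℕ} (hk : 1 ≤ k) (L : Fin n → Segment d)
    {P : Finset (EuclideanSpace ℝ (Fin d))} (hP : P.Nonempty) (hPk : P.card ≤ k) :
    (2 * k : ℕ) * loss P L ≤ 18 * gridLoss k P L := by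
  rw [loss_eq, gridLoss, Finset.mul_sum, Finset.mul_sum]
  exact Finset.sum_le_sum fun i _ => (integral_grid_bounds hk (L i) hP hPk).1

lemma gridLoss_le_loss {n k : ℕ} (hk : 1 ≤ k) (L : Fin n → Segment d)
    {P : Finset (EuclideanSpace ℝ (Fin d))} (hP : P.Nonempty) (hPk : P.card ≤ k) :
    gridLoss k P L ≤ 18 * ((2 * k : ℕ) * loss P L) := by
  rw [loss_eq, gridLoss, Finset.mul_sum, Finset.mul_sum]
  exact Finset.sum_le_sum fun i _ => (integral_grid_bounds hk (L i) hP hPk).2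

end Grid

end SegClust

end

noncomputable section

namespace SegClust

/-! ### The potential of `D²`-sampling -/

/-- Cauchy–Schwarz in the form needed for the unhit clusters: after one of u of them is sampled
proportionally to cost, a fraction of at most (u - 1)/u of the unhit cost is left on average. -/
lemma sum_mul_sum_sub_le {α : Type*} (s : Finset α) (f : α → ℝ) :
    s.card * ∑ A ∈ s, f A * (∑ B ∈ s, f B - f A) ≤ ((s.card : ℝ) - 1) * (∑ A ∈ s, f A) ^ 2 := by
  have h := sq_sum_le_card_mul_sum_sq (s := s) (f := f)
  have h1 : ∑ A ∈ s, f A * (∑ B ∈ s, f B - f A) = (∑ A ∈ s, f A) ^ 2 - ∑ A ∈ s, f A ^ 2 := by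
    simp only [mul_sub, Finset.sum_sub_distrib, ← Finset.sum_mul]
    simp only [sq]
  rw [h1]
  linarith

section Potential

variable {ι κ E : Type*} [Fintype ι] [DecidableEq κ] [PseudoMetricSpace E]

/-- The indices that an assignment maps to a given cluster. -/
def cluster (a : ι → κ) (A : κ) : Finset ι := Finset.univ.filter fun i => a i = A

/-- The mean over a point of a cluster of the sum of squared distances to the cluster. -/
def spread (X : ι → E) (a : ι → κ) (A : κ) : ℝ :=
  (∑ i ∈ cluster a A, ∑ j ∈ cluster a A, dist (X i) (X j) ^ 2) / (cluster a A).card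

lemma spread_nonneg (X : ι → E) (a : ι → κ) (A : κ) : 0 ≤ spread X a A := by
  unfold spread; positivity

lemma card_mul_spread (X : ι → E) (a : ι → κ) (A : κ) :
    (cluster a A).card * spread X a A =
      ∑ i ∈ cluster a A, ∑ j ∈ cluster a A, dist (X i) (X j) ^ 2 := by
  unfold spread
  rcases (cluster a A).eq_empty_or_nonempty with h | h
  · simp [h]
  · rw [mul_div_cancel₀]
    exact_mod_cast h.card_pos.ne'

/-- Go from each point to each other point through c; the double sum gives 4|A| times the cost with
centre c. -/
lemma spread_le (X : ι → E) (a : ι → κ) (A : κ) (c : E) :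
    spread X a A ≤ 4 * ∑ i ∈ cluster a A, dist c (X i) ^ 2 := by
  unfold spread
  refine div_le_of_le_mul₀ (by positivity) (by positivity) ?_
  calc ∑ i ∈ cluster a A, ∑ j ∈ cluster a A, dist (X i) (X j) ^ 2
      ≤ ∑ i ∈ cluster a A, ∑ j ∈ cluster a A,
          (2 * dist c (X i) ^ 2 + 2 * dist c (X j) ^ 2) := by
        refine Finset.sum_le_sum fun i _ => Finset.sum_le_sum fun j _ => ?_
        rw [dist_comm c (X i)]
        exact dist_sq_le_two_mul _ _ _
    _ = _ := by
        simp only [Finset.sum_add_distrib, Finset.sum_const, nsmul_eq_mul, ← Finset.mul_sum]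
        ring

/-- Averaging `hDX` over j bounds |A| D i by 2W + 2Q, where W is the old cost of A and Q the cost of
A with centre X i alone. The new cost is at most both Q and W; using Q against the first term and W
against the second gives 4WQ, and the Q sum to |A| times `spread`. -/
lemma sum_sq_sampling_le (X : ι → E) (a : ι → κ) (A : κ) {D : ι → ℝ} (hD : ∀ i, 0 ≤ D i)
    (hDX : ∀ i j, D i ≤ 2 * D j + 2 * dist (X i) (X j) ^ 2) :
    ∑ i ∈ cluster a A, D i * ∑ j ∈ cluster a A, min (D j) (dist (X i) (X j) ^ 2) ≤
      4 * spread X a A * ∑ i ∈ cluster a A, D i := by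
  rcases (cluster a A).eq_empty_or_nonempty with hA | hA
  · simp [hA]
  have hc : (0 : ℝ) < (cluster a A).card := by exact_mod_cast hA.card_pos
  refine le_of_mul_le_mul_left ?_ hc
  set W := ∑ i ∈ cluster a A, D i with hW
  have hW0 : 0 ≤ W := Finset.sum_nonneg fun i _ => hD i
  have key : ∀ i, (cluster a A).card * D i ≤
      2 * W + 2 * ∑ j ∈ cluster a A, dist (X i) (X j) ^ 2 := by
    intro i
    have := Finset.sum_le_sum (s := cluster a A) fun j _ => hDX i j
    simpa [Finset.sum_add_distrib, ← Finset.mul_sum] using this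
  calc (cluster a A).card *
        ∑ i ∈ cluster a A, D i * ∑ j ∈ cluster a A, min (D j) (dist (X i) (X j) ^ 2)
      = ∑ i ∈ cluster a A, ((cluster a A).card * D i) *
          ∑ j ∈ cluster a A, min (D j) (dist (X i) (X j) ^ 2) := by
        rw [Finset.mul_sum]
        exact Finset.sum_congr rfl fun i _ => by ring
    _ ≤ ∑ i ∈ cluster a A, 4 * W * ∑ j ∈ cluster a A, dist (X i) (X j) ^ 2 := by
        refine Finset.sum_le_sum fun i _ => ?_
        set Q := ∑ j ∈ cluster a A, dist (X i) (X j) ^ 2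
        set m := ∑ j ∈ cluster a A, min (D j) (dist (X i) (X j) ^ 2)
        have hQ0 : 0 ≤ Q := Finset.sum_nonneg fun j _ => sq_nonneg _
        have hm0 : 0 ≤ m := Finset.sum_nonneg fun j _ => le_min (hD j) (sq_nonneg _)
        have hmQ : m ≤ Q := Finset.sum_le_sum fun j _ => min_le_right _ _
        have hmW : m ≤ W := Finset.sum_le_sum fun j _ => min_le_left _ _
        have h1 := mul_le_mul_of_nonneg_right (key i) hm0
        have h2 := mul_le_mul_of_nonneg_left hmQ hW0
        have h3 := mul_le_mul_of_nonneg_left hmW hQ0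
        linarith
    _ = _ := by
        rw [← Finset.mul_sum, ← card_mul_spread]
        ring

variable [Fintype κ]

lemma sum_cluster (a : ι → κ) (f : ι → ℝ) : ∑ A, ∑ i ∈ cluster a A, f i = ∑ i, f i :=
  Finset.sum_fiberwise _ _ _

/-- The potential of a state of `D²`-sampling with `m` rounds to go, where `D` is the current
squared distance and `H` is the set of the clusters that have been hit. -/
def potential (X : ι → E) (a : ι → κ) (m : ℕ) (D : ι → ℝ) (H : Finset κ) : ℝ :=
  (∑ A ∈ H, ∑ i ∈ cluster a A, D i + 4 * ∑ A ∈ Hᶜ, spread X a A) * (1 + harmonic m) +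
    ((Hᶜ.card : ℝ) - m) / Hᶜ.card * ∑ A ∈ Hᶜ, ∑ i ∈ cluster a A, D i

lemma harmonic_cast_nonneg (m : ℕ) : (0 : ℝ) ≤ (harmonic m : ℝ) := by
  have : (0 : ℚ) ≤ harmonic m := Finset.sum_nonneg fun i _ => by positivity
  exact_mod_cast this

lemma potential_nonneg (X : ι → E) (a : ι → κ) {m : ℕ} {D : ι → ℝ} {H : Finset κ}
    (hD : ∀ i, 0 ≤ D i) (hm : m ≤ Hᶜ.card) : 0 ≤ potential X a m D H := by
  have h1 : ∀ s : Finset κ, 0 ≤ ∑ A ∈ s, ∑ i ∈ cluster a A, D i := fun s =>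
    Finset.sum_nonneg fun A _ => Finset.sum_nonneg fun i _ => hD i
  have h2 : 0 ≤ ∑ A ∈ Hᶜ, spread X a A := Finset.sum_nonneg fun A _ => spread_nonneg X a A
  have h3 := harmonic_cast_nonneg m
  have h4 : (0 : ℝ) ≤ (Hᶜ.card : ℝ) - m := by
    have : (m : ℝ) ≤ Hᶜ.card := by exact_mod_cast hm
    linarith
  have h5 := h1 H
  have h6 := h1 Hᶜ
  unfold potential
  positivity

lemma sum_le_potential (X : ι → E) (a : ι → κ) {D : ι → ℝ} {H : Finset κ} :
    ∑ i, D i ≤ potential X a 0 D H := by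
  have h2 : 0 ≤ ∑ A ∈ Hᶜ, spread X a A := Finset.sum_nonneg fun A _ => spread_nonneg X a A
  rw [← sum_cluster a D, ← Finset.sum_add_sum_compl H]
  unfold potential
  -- With no unhit cluster the factor is 0/0 = 0 in Lean, but the sum it multiplies is empty.
  rcases (Hᶜ).eq_empty_or_nonempty with h | h
  · simp [h]
  · have : ((Hᶜ).card : ℝ) ≠ 0 := by exact_mod_cast h.card_pos.ne'
    simp [div_self this]
    linarith

/-- The potential does not increase on average in a round of `D²`-sampling. -/
lemma sum_mul_potential_le (X : ι → E) (a : ι → κ) {m : ℕ} {D : ι → ℝ} {H : Finset κ}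
    (hD : ∀ i, 0 ≤ D i) (hDX : ∀ i j, D i ≤ 2 * D j + 2 * dist (X i) (X j) ^ 2)
    (hm : m + 1 ≤ Hᶜ.card) :
    ∑ i, D i * potential X a m (fun j => min (D j) (dist (X i) (X j) ^ 2)) (insert (a i) H) ≤
      (∑ i, D i) * potential X a (m + 1) D H := by
  set g : κ → ℝ := fun A => ∑ i ∈ cluster a A, D i with hg
  have hg0 : ∀ A, 0 ≤ g A := fun A => Finset.sum_nonneg fun i _ => hD i
  set h := ∑ A ∈ H, g A with hh
  set w := ∑ A ∈ Hᶜ, g A with hw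
  set δ := ∑ A ∈ Hᶜ, spread X a A with hδ
  set u : ℝ := (Hᶜ.card : ℝ) with hu
  set c : ℝ := 1 + harmonic m with hc
  have hc0 : 0 ≤ c := by have := harmonic_cast_nonneg m; positivity
  have hh0 : 0 ≤ h := Finset.sum_nonneg fun A _ => hg0 A
  have hw0 : 0 ≤ w := Finset.sum_nonneg fun A _ => hg0 A
  have hδ0 : 0 ≤ δ := Finset.sum_nonneg fun A _ => spread_nonneg X a A
  have hmu : (m : ℝ) + 1 ≤ u := by rw [hu]; exact_mod_cast hm
  have hu0 : 0 < u := by linarith [(Nat.cast_nonneg m : (0 : ℝ) ≤ m)]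
  set D' : ι → ι → ℝ := fun i j => min (D j) (dist (X i) (X j) ^ 2) with hD'
  have hD'D : ∀ i A, ∑ j ∈ cluster a A, D' i j ≤ g A := fun i A =>
    Finset.sum_le_sum fun j _ => min_le_left _ _
  -- A wasted round: H stays the same and distances only decrease, but m has dropped, so the factor
  -- of the unhit cost grows to (u - m)/u.
  have hit : ∀ A ∈ H, ∑ i ∈ cluster a A, D i * potential X a m (D' i) (insert (a i) H) ≤
      g A * ((h + 4 * δ) * c + (u - m) / u * w) := by
    intro A hA
    rw [hg, Finset.sum_mul]
    refine Finset.sum_le_sum fun i hi => mul_le_mul_of_nonneg_left ?_ (hD i)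
    have hai : a i = A := (Finset.mem_filter.1 hi).2
    rw [hai, Finset.insert_eq_of_mem hA]
    unfold potential
    have h1 : ∑ B ∈ H, ∑ j ∈ cluster a B, D' i j ≤ h := Finset.sum_le_sum fun B _ => hD'D i B
    have h2 : ∑ B ∈ Hᶜ, ∑ j ∈ cluster a B, D' i j ≤ w := Finset.sum_le_sum fun B _ => hD'D i B
    have h3 : 0 ≤ (u - m) / u := div_nonneg (by linarith) hu0.le
    gcongr
  -- A useful round: A leaves the unhit clusters. Its new cost is on average at most the term 4
  -- `spread` that it gives up, so h + 4δ does not grow, while g A disappears from the unhit cost.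
  have miss : ∀ A ∈ Hᶜ, ∑ i ∈ cluster a A, D i * potential X a m (D' i) (insert (a i) H) ≤
      g A * ((h + 4 * δ) * c) + (u - 1 - m) / (u - 1) * (g A * (w - g A)) := by
    intro A hA
    have hAH : A ∉ H := Finset.mem_compl.1 hA
    have hcompl : (insert A H)ᶜ = Hᶜ.erase A := Finset.compl_insert
    have hcard : (((insert A H)ᶜ).card : ℝ) = u - 1 := by
      rw [hcompl, Finset.card_erase_of_mem hA, Nat.cast_sub (by omega)]
      simp [hu]
    have hpt : ∀ i ∈ cluster a A, D i * potential X a m (D' i) (insert (a i) H) ≤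
        D i * ((h + 4 * δ) * c + (u - 1 - m) / (u - 1) * (w - g A)) +
          (D i * ∑ j ∈ cluster a A, D' i j) * c - 4 * spread X a A * D i * c := by
      intro i hi
      have hai : a i = A := (Finset.mem_filter.1 hi).2
      rw [hai]
      unfold potential
      rw [hcard, Finset.sum_insert hAH, hcompl]
      have h1 : ∑ B ∈ H, ∑ j ∈ cluster a B, D' i j ≤ h := Finset.sum_le_sum fun B _ => hD'D i B
      have h2 : ∑ B ∈ Hᶜ.erase A, ∑ j ∈ cluster a B, D' i j ≤ w - g A := by
        rw [hw, ← Finset.add_sum_erase _ _ hA, add_sub_cancel_left]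
        exact Finset.sum_le_sum fun B _ => hD'D i B
      have h3 : 0 ≤ (u - 1 - m) / (u - 1) :=
        div_nonneg (by linarith) (by linarith [(Nat.cast_nonneg m : (0 : ℝ) ≤ m)])
      have h4 : ∑ B ∈ Hᶜ.erase A, spread X a B = δ - spread X a A := by
        rw [hδ, ← Finset.add_sum_erase _ _ hA, add_sub_cancel_left]
      rw [h4]
      have h5 := mul_le_mul_of_nonneg_left h2 h3
      have h6 := mul_le_mul_of_nonneg_right h1 hc0
      have h7 := mul_le_mul_of_nonneg_left (add_le_add h5 h6) (hD i)
      simp only [← hc]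
      linarith
    refine (Finset.sum_le_sum hpt).trans ?_
    have h8 := mul_le_mul_of_nonneg_right (sum_sq_sampling_le X a A hD hDX) hc0
    rw [Finset.sum_sub_distrib, Finset.sum_add_distrib, ← Finset.sum_mul, ← Finset.sum_mul,
      ← Finset.sum_mul, ← Finset.mul_sum]
    change _ ≤ 4 * spread X a A * g A * c at h8
    change g A * _ + _ - 4 * spread X a A * g A * c ≤ _
    linarith
  have total : ∑ i, D i = h + w := by
    rw [← sum_cluster a D, ← Finset.sum_add_sum_compl H]
  have hsplit : ∑ i, D i * potential X a m (D' i) (insert (a i) H) ≤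
      h * ((h + 4 * δ) * c + (u - m) / u * w) + (w * ((h + 4 * δ) * c) +
        (u - 1 - m) / (u - 1) * ∑ A ∈ Hᶜ, g A * (w - g A)) := by
    rw [← sum_cluster a, ← Finset.sum_add_sum_compl H]
    refine add_le_add ((Finset.sum_le_sum hit).trans_eq ?_)
      ((Finset.sum_le_sum miss).trans_eq ?_)
    · rw [← Finset.sum_mul]
    · rw [Finset.sum_add_distrib, ← Finset.sum_mul, ← Finset.mul_sum]
  have hlast : (u - 1 - m) / (u - 1) * ∑ A ∈ Hᶜ, g A * (w - g A) ≤ (u - 1 - m) / u * w ^ 2 := by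
    have h1 := sum_mul_sum_sub_le Hᶜ g
    rw [← hw, ← hu] at h1
    -- For u = 1 the division by u - 1 is a division by zero; then m = 0 and both sides vanish.
    rcases eq_or_lt_of_le (by linarith [(Nat.cast_nonneg m : (0 : ℝ) ≤ m)] : 1 ≤ u) with h2 | h2
    · have : (m : ℝ) = 0 := by linarith [(Nat.cast_nonneg m : (0 : ℝ) ≤ m)]
      rw [← h2, this]
      simp
    · have h3 : 0 < u - 1 := by linarith
      have h4 : ∑ A ∈ Hᶜ, g A * (w - g A) ≤ (u - 1) / u * w ^ 2 := by
        rw [div_mul_eq_mul_div, le_div_iff₀ hu0]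
        linarith
      calc _ ≤ (u - 1 - m) / (u - 1) * ((u - 1) / u * w ^ 2) := by
            gcongr
            exact div_nonneg (by linarith) h3.le
        _ = _ := by field_simp
  -- The excess hw/u from wasted rounds is paid for by the term 1/(m+1) that the harmonic number
  -- loses; this is where m + 1 ≤ u is needed.
  have hgain : h * w / u ≤ (h + w) * ((h + 4 * δ) / (m + 1)) := by
    have hm1 : (0 : ℝ) < m + 1 := by positivity
    calc h * w / u ≤ h * w / (m + 1) := by gcongr
      _ ≤ (h + w) * (h + 4 * δ) / (m + 1) := by
        refine div_le_div_of_nonneg_right ?_ hm1.le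
        nlinarith [mul_nonneg hh0 hδ0, mul_nonneg hw0 hδ0, mul_nonneg hh0 hh0]
      _ = _ := by ring
  have hpot : potential X a (m + 1) D H =
      (h + 4 * δ) * (c + 1 / (m + 1)) + (u - (m + 1)) / u * w := by
    unfold potential
    rw [harmonic_succ]
    push_cast
    rw [hc, ← add_assoc, one_div]
  rw [total, hpot]
  refine hsplit.trans ?_
  have e1 : h * ((u - m) / u * w) = h * ((u - 1 - m) / u * w) + h * w / u := by
    field_simp; ring
  have e2 : (h + w) * ((h + 4 * δ) * (c + 1 / (m + 1)) + (u - (m + 1)) / u * w) =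
      (h + w) * ((h + 4 * δ) * c) + (h + w) * ((h + 4 * δ) / (m + 1)) +
        h * ((u - 1 - m) / u * w) + (u - 1 - m) / u * w ^ 2 := by
    field_simp; ring
  rw [e2]
  linarith

/-- The average potential after a uniform choice of the first centre. -/
lemma sum_potential_singleton_le (X : ι → E) (a : ι → κ) {m : ℕ} (hm : m + 1 = Fintype.card κ) :
    ∑ i, potential X a m (fun j => dist (X i) (X j) ^ 2) {a i} ≤
      Fintype.card ι * (4 * (1 + harmonic m) * ∑ A, spread X a A) := by
  set δ := ∑ A, spread X a A with hδ
  have hc0 := harmonic_cast_nonneg m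
  -- After the first centre as many rounds as unhit clusters remain, so the unhit cost has
  -- coefficient zero.
  have hcard : ∀ A : κ, ((({A} : Finset κ)ᶜ).card : ℝ) - m = 0 := by
    intro A
    rw [Finset.card_compl, Finset.card_singleton, ← hm]
    simp
  have hpt : ∀ i, potential X a m (fun j => dist (X i) (X j) ^ 2) {a i} =
      (∑ j ∈ cluster a (a i), dist (X i) (X j) ^ 2 + 4 * (δ - spread X a (a i))) *
        (1 + harmonic m) := by
    intro i
    unfold potential
    rw [hcard, zero_div, zero_mul, add_zero, Finset.sum_singleton, hδ,
      ← Finset.sum_add_sum_compl {a i} (spread X a), Finset.sum_singleton, add_sub_cancel_left]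
  simp only [hpt]
  rw [← Finset.sum_mul, ← sum_cluster a]
  have h1 : ∀ A, ∑ i ∈ cluster a A,
      (∑ j ∈ cluster a (a i), dist (X i) (X j) ^ 2 + 4 * (δ - spread X a (a i))) ≤
      ∑ i ∈ cluster a A, 4 * δ := by
    intro A
    have h2 : ∑ i ∈ cluster a A,
        (∑ j ∈ cluster a (a i), dist (X i) (X j) ^ 2 + 4 * (δ - spread X a (a i))) =
        ∑ i ∈ cluster a A,
          (∑ j ∈ cluster a A, dist (X i) (X j) ^ 2 + 4 * (δ - spread X a A)) :=
      Finset.sum_congr rfl fun i hi => by rw [(Finset.mem_filter.1 hi).2]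
    rw [h2, Finset.sum_add_distrib, ← card_mul_spread]
    simp only [Finset.sum_const, nsmul_eq_mul]
    have := mul_nonneg ((cluster a A).card.cast_nonneg (α := ℝ)) (spread_nonneg X a A)
    linarith
  calc _ ≤ (∑ A, ∑ i ∈ cluster a A, 4 * δ) * (1 + harmonic m : ℝ) := by
        exact mul_le_mul_of_nonneg_right (Finset.sum_le_sum fun A _ => h1 A) (by linarith)
    _ = _ := by
        rw [sum_cluster]
        simp only [Finset.sum_const, Finset.card_univ, nsmul_eq_mul]
        ring

/-- There is an assignment to `k` clusters whose spread is dominated by the cost of every set of `k`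
centres. -/
lemma exists_assignment_spread_le (X : ι → E) {k : ℕ} (hk : 1 ≤ k) :
    ∃ a : ι → Fin k, ∀ P : Finset E, P.card = k →
      ∑ A, spread X a A ≤ 4 * ∑ i, sqDist P (X i) := by
  classical
  have : NeZero k := ⟨by omega⟩
  -- Minimising over the finitely many assignments avoids having to know that an optimal set of
  -- centres exists. A given P competes through its nearest-centre assignment.
  obtain ⟨a, ha⟩ := Finite.exists_min fun a : ι → Fin k => ∑ A, spread X a A
  refine ⟨a, fun P hP => ?_⟩
  have hne : P.Nonempty := Finset.card_pos.1 (by omega)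
  choose c hcP hc using fun i => exists_sqDist_eq hne (X i)
  let e := P.equivFinOfCardEq hP
  refine (ha fun i => e ⟨c i, hcP i⟩).trans ?_
  rw [← sum_cluster (fun i => e ⟨c i, hcP i⟩), Finset.mul_sum]
  refine Finset.sum_le_sum fun A _ => (spread_le X _ A (e.symm A : E)).trans_eq ?_
  congr 1
  refine Finset.sum_congr rfl fun i hi => ?_
  rw [hc, ← (Finset.mem_filter.1 hi).2, Equiv.symm_apply_apply]

end Potential

end SegClust

end

noncomputable section

namespace SegClust

/-! ### Splitting the random source -/

section Tape

/-- The random source after `m` numbers have been used. -/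
def Tape.drop (m : ℕ) (ω : Tape) : Tape := fun t => ω (m + t)

instance : IsProbabilityMeasure tapeMeasure := by unfold tapeMeasure; infer_instance

/-- Infinite product measures are determined by finite boxes, and prepending a coordinate pulls a
box back to a product of a set and a box. -/
lemma map_cons_tapeMeasure :
    ((volume : Measure unitInterval).prod tapeMeasure).map
      (fun p => (fun t => Nat.casesOn t p.1 p.2 : Tape)) = tapeMeasure := by
  have hmeas : Measurable fun p : unitInterval × Tape =>
      (fun t => Nat.casesOn t p.1 p.2 : Tape) := by
    refine measurable_pi_lambda _ fun t => ?_
    cases t with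
    | zero => exact measurable_fst
    | succ t => exact (measurable_pi_apply t).comp measurable_snd
  refine Measure.eq_infinitePi _ fun s t ht => ?_
  rw [Measure.map_apply hmeas (MeasurableSet.pi s.countable_toSet fun i _ => ht i)]
  have hpre : (fun p : unitInterval × Tape => (fun t => Nat.casesOn t p.1 p.2 : Tape)) ⁻¹'
      Set.pi s t = {x | 0 ∈ s → x ∈ t 0} ×ˢ
        Set.pi (s.preimage Nat.succ Nat.succ_injective.injOn) fun i => t (i + 1) := by
    ext p
    simp only [Set.mem_preimage, Set.mem_pi, Set.mem_prod, Set.mem_ofPred_eq, Finset.mem_coe,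
      Finset.mem_preimage]
    constructor
    · exact fun h => ⟨h 0, fun i hi => h (i + 1) hi⟩
    · rintro ⟨h0, h1⟩ i hi
      cases i with
      | zero => exact h0 hi
      | succ i => exact h1 i hi
  rw [hpre, Measure.prod_prod, tapeMeasure, Measure.infinitePi_pi _ fun i _ => ht (i + 1)]
  classical
  rw [Finset.prod_preimage' Nat.succ s _ fun i => volume (t i)]
  by_cases h0 : 0 ∈ s
  · have h1 : s.filter (fun x => x ∈ Set.range Nat.succ) = s.erase 0 := by
      ext x
      cases x <;> simp
    rw [h1, ← Finset.mul_prod_erase s _ h0]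
    simp [h0]
  · have h1 : s.filter (fun x => x ∈ Set.range Nat.succ) = s := by
      refine Finset.filter_true_of_mem fun x hx => ?_
      cases x with
      | zero => exact absurd hx h0
      | succ x => exact ⟨x, rfl⟩
    rw [h1]
    simp [h0]

/-- Independence as an inequality of outer measures: passing to measurable hulls makes it valid for
arbitrary sets, so no event about the algorithm has to be shown measurable. -/
lemma tapeMeasure_head_tail_le (A : Set unitInterval) (B : Set Tape) :
    tapeMeasure {ω | ω 0 ∈ A ∧ ω.drop 1 ∈ B} ≤ volume A * tapeMeasure B := by
  have hm : Measurable (Tape.drop 1) := measurable_pi_lambda _ fun t => measurable_pi_apply _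
  have hmeas : Measurable fun p : unitInterval × Tape =>
      (fun t => Nat.casesOn t p.1 p.2 : Tape) := by
    refine measurable_pi_lambda _ fun t => ?_
    cases t with
    | zero => exact measurable_fst
    | succ t => exact (measurable_pi_apply t).comp measurable_snd
  have main : ∀ (A' : Set unitInterval) (B' : Set Tape), MeasurableSet A' → MeasurableSet B' →
      tapeMeasure {ω | ω 0 ∈ A' ∧ ω.drop 1 ∈ B'} = volume A' * tapeMeasure B' := by
    intro A' B' hA hB
    have hAB : MeasurableSet {ω : Tape | ω 0 ∈ A' ∧ ω.drop 1 ∈ B'} :=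
      (measurable_pi_apply 0 hA).inter (hm hB)
    conv_lhs => rw [← map_cons_tapeMeasure]
    rw [Measure.map_apply hmeas hAB, ← Measure.prod_prod]
    congr 1
    ext p
    have : Tape.drop 1 (fun t => Nat.casesOn t p.1 p.2) = p.2 := by
      funext t
      rw [Tape.drop, Nat.add_comm]
    simp [this]
  calc tapeMeasure {ω | ω 0 ∈ A ∧ ω.drop 1 ∈ B}
      ≤ tapeMeasure {ω | ω 0 ∈ toMeasurable volume A ∧
          ω.drop 1 ∈ toMeasurable tapeMeasure B} :=
        measure_mono fun ω h => ⟨subset_toMeasurable _ _ h.1, subset_toMeasurable _ _ h.2⟩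
    _ = volume A * tapeMeasure B := by
        rw [main _ _ (measurableSet_toMeasurable _ _) (measurableSet_toMeasurable _ _),
          measure_toMeasurable, measure_toMeasurable]

end Tape

/-! ### Sampling an index with given weights -/

section Choose

/-- The number of prefix sums of the weights that are at most `r`. -/
def chooseIdx (w : ℕ → ℝ) (N : ℕ) (r : ℝ) : ℕ :=
  ((Finset.range N).filter fun i => ∑ m ∈ Finset.range (i + 1), w m ≤ r).card

lemma chooseIdx_le (w : ℕ → ℝ) (N : ℕ) (r : ℝ) : chooseIdx w N r ≤ N :=
  (Finset.card_filter_le _ _).trans (Finset.card_range N).le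

lemma chooseIdx_succ (w : ℕ → ℝ) (N : ℕ) (r : ℝ) :
    chooseIdx w (N + 1) r =
      if ∑ m ∈ Finset.range (N + 1), w m ≤ r then chooseIdx w N r + 1 else chooseIdx w N r := by
  have key : ∀ (p : ℕ → Prop) [DecidablePred p], ((Finset.range (N + 1)).filter p).card =
      if p N then ((Finset.range N).filter p).card + 1 else ((Finset.range N).filter p).card := by
    intro p _
    rw [Finset.range_add_one, Finset.filter_insert]
    split_ifs with h
    · rw [Finset.card_insert_of_notMem (by simp)]
    · rfl
  exact key _

/-- Prefix sums of nonnegative weights increase, so the counted indices form an initial segment and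
the count is the first index not counted. -/
lemma lt_chooseIdx_iff {w : ℕ → ℝ} (hw : ∀ i, 0 ≤ w i) {N : ℕ} {r : ℝ} {i : ℕ} (hi : i < N) :
    i < chooseIdx w N r ↔ ∑ m ∈ Finset.range (i + 1), w m ≤ r := by
  induction N with
  | zero => omega
  | succ N ih =>
    have hmono : ∀ {a b : ℕ}, a ≤ b →
        ∑ m ∈ Finset.range (a + 1), w m ≤ ∑ m ∈ Finset.range (b + 1), w m := fun h =>
      Finset.sum_le_sum_of_subset_of_nonneg (Finset.range_mono (by omega)) fun j _ _ => hw j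
    by_cases h : ∑ m ∈ Finset.range (N + 1), w m ≤ r
    · have hall : chooseIdx w N r = N := by
        unfold chooseIdx
        rw [Finset.filter_true_of_mem, Finset.card_range]
        intro j hj
        exact (hmono (Finset.mem_range.1 hj).le).trans h
      rw [chooseIdx_succ, if_pos h, hall]
      exact ⟨fun _ => (hmono (by omega)).trans h, fun _ => hi⟩
    · rw [chooseIdx_succ, if_neg h]
      rcases Nat.lt_succ_iff_lt_or_eq.1 hi with h1 | rfl
      · exact ih h1
      · exact ⟨fun h2 => absurd (chooseIdx_le w i r) (by omega), fun h2 => absurd h2 h⟩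

lemma chooseIdx_spec {w : ℕ → ℝ} (hw : ∀ i, 0 ≤ w i) {N : ℕ} {r : ℝ} (hr : 0 ≤ r)
    (h : chooseIdx w N r < N) :
    ∑ m ∈ Finset.range (chooseIdx w N r), w m ≤ r ∧
      r < ∑ m ∈ Finset.range (chooseIdx w N r + 1), w m := by
  constructor
  · rcases Nat.eq_zero_or_pos (chooseIdx w N r) with h0 | h0
    · rw [h0]
      simpa using hr
    · have := (lt_chooseIdx_iff hw (N := N) (r := r) (i := chooseIdx w N r - 1) (by omega)).1
        (by omega)
      rwa [Nat.sub_add_cancel h0] at this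
  · exact not_le.1 fun h1 => lt_irrefl _ ((lt_chooseIdx_iff hw h).2 h1)

lemma weight_chooseIdx_pos {w : ℕ → ℝ} (hw : ∀ i, 0 ≤ w i) {N : ℕ} {r : ℝ} (hr : 0 ≤ r)
    (h : chooseIdx w N r < N) : 0 < w (chooseIdx w N r) := by
  have := chooseIdx_spec hw hr h
  rw [Finset.sum_range_succ] at this
  linarith

lemma volume_unitInterval_le {s : Set unitInterval} {x y : ℝ}
    (h : ∀ u ∈ s, x ≤ u.1 ∧ u.1 ≤ y) : volume s ≤ ENNReal.ofReal (y - x) := by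
  rw [unitInterval.volume_apply, ← Real.volume_Icc]
  refine measure_mono ?_
  rintro _ ⟨u, hu, rfl⟩
  exact h u hu

lemma volume_chooseIdx_eq_le {w : ℕ → ℝ} (hw : ∀ i, 0 ≤ w i) {N : ℕ}
    (hS : 0 < ∑ m ∈ Finset.range N, w m) {i : ℕ} (hi : i < N) :
    volume {u : unitInterval | chooseIdx w N (u * ∑ m ∈ Finset.range N, w m) = i} ≤
      ENNReal.ofReal (w i / ∑ m ∈ Finset.range N, w m) := by
  set S := ∑ m ∈ Finset.range N, w m with hSdef
  have : w i / S = (∑ m ∈ Finset.range (i + 1), w m) / S - (∑ m ∈ Finset.range i, w m) / S := by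
    rw [Finset.sum_range_succ]; ring
  rw [this]
  refine volume_unitInterval_le fun u hu => ?_
  have hu' : chooseIdx w N (u * S) = i := hu
  have := chooseIdx_spec hw (mul_nonneg u.2.1 hS.le) (hu'.trans_lt hi)
  rw [hu'] at this
  exact ⟨(div_le_iff₀ hS).2 this.1, (le_div_iff₀ hS).2 this.2.le⟩

/-- No index is selected only if even the full sum S is at most uS, which forces u = 1. -/
lemma volume_chooseIdx_eq_last {w : ℕ → ℝ} (hw : ∀ i, 0 ≤ w i) {N : ℕ}
    (hS : 0 < ∑ m ∈ Finset.range N, w m) :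
    volume {u : unitInterval | chooseIdx w N (u * ∑ m ∈ Finset.range N, w m) = N} = 0 := by
  set S := ∑ m ∈ Finset.range N, w m with hSdef
  refine le_antisymm ?_ zero_le
  have : (0 : ENNReal) = ENNReal.ofReal (1 - 1) := by simp
  rw [this]
  refine volume_unitInterval_le fun u hu => ⟨?_, u.2.2⟩
  have hu' : chooseIdx w N (u * S) = N := hu
  have hN : 0 < N := by
    rcases Nat.eq_zero_or_pos N with h | h
    · rw [hSdef, h] at hS; simp at hS
    · exact h
  have := (lt_chooseIdx_iff hw (N := N) (r := u * S) (i := N - 1) (by omega)).1 (by omega)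
  rw [Nat.sub_add_cancel hN, ← hSdef] at this
  exact le_of_mul_le_mul_right (by linarith) hS

end Choose

end SegClust

end

noncomputable section

namespace SegClust

/-! ### Seeding by `D²`-sampling -/

section Seeding

variable {E : Type*} [PseudoMetricSpace E]

open Classical in
/-- The sampling weights when the centres `cs` have been chosen: all weights are one in the
beginning. -/
def weight (X : ℕ → E) (cs : List E) (i : ℕ) : ℝ :=
  if cs = [] then 1 else sqDist cs.toFinset (X i)

/-- The next centre: a sampled point, or `fb cs` when no point was selected. -/
def nextCentre (X : ℕ → E) (N : ℕ) (fb : List E → E) (cs : List E) (x : unitInterval) : E :=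
  if chooseIdx (weight X cs) N (x * ∑ m ∈ Finset.range N, weight X cs m) < N then
    X (chooseIdx (weight X cs) N (x * ∑ m ∈ Finset.range N, weight X cs m)) else fb cs

/-- The centres after `m` further rounds. -/
def seeding (X : ℕ → E) (N : ℕ) (fb : List E → E) : List E → ℕ → Tape → List E
  | cs, 0, _ => cs
  | cs, m + 1, ω => seeding X N fb (cs ++ [nextCentre X N fb cs (ω 0)]) m (ω.drop 1)

open Classical in
/-- The sum of the squared distances of the first `N` points to the centres. -/
def cost (X : ℕ → E) (N : ℕ) (cs : List E) : ℝ :=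
  ∑ i ∈ Finset.range N, sqDist cs.toFinset (X i)

lemma Tape.drop_drop (a b : ℕ) (ω : Tape) : (ω.drop a).drop b = ω.drop (a + b) := by
  funext t
  simp [Tape.drop, Nat.add_assoc]

lemma Tape.drop_zero (ω : Tape) : ω.drop 0 = ω := by
  funext t
  simp [Tape.drop]

variable (X : ℕ → E) (N : ℕ) (fb : List E → E)

/-- The recursion of `seeding` peels off the first round, as the probability argument needs; the
program's loop invariant needs the last round. -/
lemma seeding_succ (cs : List E) (m : ℕ) (ω : Tape) :
    seeding X N fb cs (m + 1) ω =
      seeding X N fb cs m ω ++ [nextCentre X N fb (seeding X N fb cs m ω) (ω m)] := by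
  induction m generalizing cs ω with
  | zero => rfl
  | succ m ih =>
    rw [seeding, ih]
    have : Tape.drop 1 ω m = ω (m + 1) := by rw [Tape.drop, Nat.add_comm]
    rw [this]
    rfl

lemma length_seeding (cs : List E) (m : ℕ) (ω : Tape) :
    (seeding X N fb cs m ω).length = cs.length + m := by
  induction m with
  | zero => rfl
  | succ m ih => rw [seeding_succ, List.length_append, ih]; rfl

lemma weight_nonneg (cs : List E) (i : ℕ) : 0 ≤ weight X cs i := by
  unfold weight
  split_ifs
  · exact zero_le_one
  · exact sqDist_nonneg _ _

lemma sum_weight_nonneg (cs : List E) : 0 ≤ ∑ m ∈ Finset.range N, weight X cs m :=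
  Finset.sum_nonneg fun i _ => weight_nonneg X cs i

lemma weight_append {cs : List E} (hcs : cs ≠ []) (c : E) (i : ℕ) :
    weight X (cs ++ [c]) i = min (weight X cs i) (dist c (X i) ^ 2) := by
  classical
  unfold weight
  rw [if_neg hcs, if_neg (by simp), List.toFinset_append, Finset.union_comm]
  change sqDist ({c} ∪ _) _ = _
  rw [← Finset.insert_eq, sqDist_insert (List.toFinset_nonempty_iff _ |>.2 hcs)]

lemma weight_singleton (c : E) (i : ℕ) : weight X [c] i = dist c (X i) ^ 2 := by
  classical
  unfold weight
  rw [if_neg (by simp)]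
  exact sqDist_singleton c (X i)

lemma cost_eq {cs : List E} (hcs : cs ≠ []) :
    cost X N cs = ∑ i ∈ Finset.range N, weight X cs i := by
  classical
  exact Finset.sum_congr rfl fun i _ => by rw [weight, if_neg hcs]

lemma cost_seeding_le {cs : List E} (hcs : cs ≠ []) (m : ℕ) (ω : Tape) :
    cost X N (seeding X N fb cs m ω) ≤ cost X N cs := by
  induction m generalizing cs ω with
  | zero => rfl
  | succ m ih =>
    refine (ih (by simp) _).trans ?_
    rw [cost_eq X N hcs, cost_eq X N (by simp)]
    refine Finset.sum_le_sum fun i _ => ?_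
    rw [weight_append X hcs]
    exact min_le_left _ _

/-- A selected index has positive weight, hence a point at positive distance from all centres. If
every weight is zero, all prefix sums are counted and the fallback is taken. -/
lemma nextCentre_notMem (hfb : ∀ cs, fb cs ∉ cs) (cs : List E) (x : unitInterval) :
    nextCentre X N fb cs x ∉ cs := by
  classical
  unfold nextCentre
  split_ifs with h
  · have hpos := weight_chooseIdx_pos (weight_nonneg X cs)
      (mul_nonneg x.2.1 (sum_weight_nonneg X N cs)) h
    by_cases hcs : cs = []
    · simp [hcs]
    · rw [weight, if_neg hcs] at hpos
      exact fun hmem => notMem_of_sqDist_pos hpos (List.mem_toFinset.2 hmem)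
  · exact hfb cs

lemma nodup_seeding (hfb : ∀ cs, fb cs ∉ cs) (m : ℕ) (ω : Tape) :
    (seeding X N fb [] m ω).Nodup := by
  induction m with
  | zero => exact List.nodup_nil
  | succ m ih =>
    rw [seeding_succ, List.nodup_append]
    refine ⟨ih, List.nodup_singleton _, fun a ha b hb => ?_⟩
    rw [List.mem_singleton.1 hb]
    rintro rfl
    exact nextCentre_notMem X N fb hfb _ _ ha

/-- One round: the probability of an event after the round is at most the average of bounds for
the possible choices. -/
lemma measure_round_le (cs : List E) (hS : 0 < ∑ m ∈ Finset.range N, weight X cs m)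
    (T : E → Set Tape) (g : ℕ → ℝ) (hg : ∀ i, 0 ≤ g i) (K : ENNReal)
    (hT : ∀ i < N, tapeMeasure (T (X i)) ≤ ENNReal.ofReal (g i) * K) :
    tapeMeasure {ω | ω.drop 1 ∈ T (nextCentre X N fb cs (ω 0))} ≤
      ENNReal.ofReal ((∑ i ∈ Finset.range N, weight X cs i * g i) /
        ∑ m ∈ Finset.range N, weight X cs m) * K := by
  set S := ∑ m ∈ Finset.range N, weight X cs m with hSdef
  have hw := weight_nonneg X cs
  set J : ℕ → Set unitInterval := fun i => {x | chooseIdx (weight X cs) N (x * S) = i} with hJ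
  -- Split by the selected index. The fallback case has probability zero, so nothing about `fb`
  -- enters the bound.
  have hsub : {ω : Tape | ω.drop 1 ∈ T (nextCentre X N fb cs (ω 0))} ⊆
      (⋃ i ∈ Finset.range N, {ω : Tape | ω 0 ∈ J i ∧ ω.drop 1 ∈ T (X i)}) ∪
        {ω : Tape | ω 0 ∈ J N ∧ ω.drop 1 ∈ Set.univ} := by
    intro ω hω
    have hω' : ω.drop 1 ∈ T (nextCentre X N fb cs (ω 0)) := hω
    by_cases h : chooseIdx (weight X cs) N (ω 0 * S) < N
    · left
      refine Set.mem_biUnion (Finset.mem_coe.2 (Finset.mem_range.2 h)) ⟨rfl, ?_⟩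
      rw [nextCentre, ← hSdef, if_pos h] at hω'
      exact hω'
    · right
      exact ⟨le_antisymm (chooseIdx_le _ _ _) (not_lt.1 h), Set.mem_univ _⟩
  calc tapeMeasure {ω | ω.drop 1 ∈ T (nextCentre X N fb cs (ω 0))}
      ≤ ∑ i ∈ Finset.range N, tapeMeasure {ω : Tape | ω 0 ∈ J i ∧ ω.drop 1 ∈ T (X i)} +
          tapeMeasure {ω : Tape | ω 0 ∈ J N ∧ ω.drop 1 ∈ Set.univ} :=
        (measure_mono hsub).trans ((measure_union_le _ _).trans
          (add_le_add_left (measure_biUnion_finset_le _ _) _))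
    _ ≤ ∑ i ∈ Finset.range N, ENNReal.ofReal (weight X cs i * g i / S) * K + 0 := by
        refine add_le_add (Finset.sum_le_sum fun i hi => ?_) ?_
        · rw [Finset.mem_range] at hi
          refine (tapeMeasure_head_tail_le _ _).trans ?_
          have h1 : weight X cs i * g i / S = weight X cs i / S * g i := by ring
          rw [h1, ENNReal.ofReal_mul (div_nonneg (hw i) hS.le), mul_assoc]
          exact mul_le_mul' (volume_chooseIdx_eq_le hw hS hi) (hT i hi)
        · refine (tapeMeasure_head_tail_le _ _).trans ?_
          rw [volume_chooseIdx_eq_last hw hS, zero_mul]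
    _ = _ := by
        rw [add_zero, ← Finset.sum_mul, ← ENNReal.ofReal_sum_of_nonneg, Finset.sum_div]
        exact fun i _ => div_nonneg (mul_nonneg (hw i) (hg i)) hS.le

variable {κ : Type*} [Fintype κ] [DecidableEq κ]

lemma weight_le_two_mul {cs : List E} (hcs : cs ≠ []) (i j : ℕ) :
    weight X cs i ≤ 2 * weight X cs j + 2 * dist (X i) (X j) ^ 2 := by
  classical
  simp only [weight, if_neg hcs]
  rw [dist_comm]
  exact sqDist_le_two_mul (List.toFinset_nonempty_iff _ |>.2 hcs) _ _

/-- Markov's inequality and the supermartingale property in a single induction on the rounds to go,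
without any expectation. The event B about the unused tape is carried along so that independent
trials can be chained. -/
lemma measure_seeding_le (a : Fin N → κ) {c : ℝ} (hc : 0 ≤ c) (B : Set Tape) (m : ℕ)
    {cs : List E} (hcs : cs ≠ []) (H : Finset κ) (hm : m ≤ Hᶜ.card) :
    tapeMeasure {ω | c < cost X N (seeding X N fb cs m ω) ∧ ω.drop m ∈ B} ≤
      ENNReal.ofReal (potential (fun i : Fin N => X i) a m (fun i => weight X cs i) H) *
        ((ENNReal.ofReal c)⁻¹ * tapeMeasure B) := by
  induction m generalizing cs H with
  | zero =>
    simp only [seeding, Tape.drop_zero]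
    by_cases h : c < cost X N cs
    · have h1 : c < potential (fun i : Fin N => X i) a 0 (fun i => weight X cs i) H := by
        refine h.trans_le ?_
        rw [cost_eq X N hcs, Finset.sum_range]
        exact sum_le_potential _ _
      have h2 : 1 ≤ ENNReal.ofReal (potential (fun i : Fin N => X i) a 0
          (fun i => weight X cs i) H) * (ENNReal.ofReal c)⁻¹ := by
        rw [← div_eq_mul_inv]
        -- For c = 0 the inverse is ∞, and the bound is trivial because the potential is positive.
        rcases hc.eq_or_lt with rfl | h0
        · rw [ENNReal.ofReal_zero, ENNReal.div_zero (by simpa using h1)]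
          exact le_top
        · rw [ENNReal.le_div_iff_mul_le (by simp [h0]) (by simp), one_mul]
          exact ENNReal.ofReal_le_ofReal h1.le
      rw [← mul_assoc]
      calc tapeMeasure _ ≤ 1 * tapeMeasure B := by
            rw [one_mul]; exact measure_mono fun ω hω => hω.2
        _ ≤ _ := mul_le_mul_left h2 _
    · simp [h]
  | succ m ih =>
    have hw := weight_nonneg X cs
    -- With total weight zero nothing can be sampled, but the cost is already zero and stays at most
    -- c.
    rcases (sum_weight_nonneg X N cs).eq_or_lt with hS | hS
    · have : {ω : Tape | c < cost X N (seeding X N fb cs (m + 1) ω) ∧ ω.drop (m + 1) ∈ B} = ∅ := by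
        refine Set.eq_empty_of_forall_notMem fun ω hω => ?_
        have h1 := cost_seeding_le X N fb hcs (m + 1) ω
        rw [cost_eq X N hcs, ← hS] at h1
        exact absurd hω.1 (not_lt.2 (h1.trans hc))
      simp [this]
    set G : ℕ → ℝ := fun i => if h : i < N then potential (fun i : Fin N => X i) a m
      (fun j => weight X (cs ++ [X i]) j) (insert (a ⟨i, h⟩) H) else 0 with hG
    have hcard : ∀ A, m ≤ (insert A H)ᶜ.card := fun A => by
      rw [Finset.compl_insert]
      have := Finset.pred_card_le_card_erase (a := A) (s := Hᶜ)
      omega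
    have hG0 : ∀ i, 0 ≤ G i := by
      intro i
      simp only [hG]
      split_ifs with h
      · exact potential_nonneg _ _ (fun j => weight_nonneg X _ _) (hcard _)
      · exact le_rfl
    have hround := measure_round_le X N fb cs hS
      (fun p => {ω | c < cost X N (seeding X N fb (cs ++ [p]) m ω) ∧ ω.drop m ∈ B}) G hG0
      ((ENNReal.ofReal c)⁻¹ * tapeMeasure B) fun i hi => by
        simp only [hG, dif_pos hi]
        exact ih (by simp) _ (hcard _)
    refine (le_trans (le_of_eq ?_) hround).trans ?_
    · congr 1
      ext ω
      simp only [Set.mem_ofPred_eq, seeding, Tape.drop_drop, Nat.add_comm 1 m]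
    · refine mul_le_mul_left (ENNReal.ofReal_le_ofReal ?_) _
      rw [div_le_iff₀ hS, mul_comm, Finset.sum_range, Finset.sum_range]
      refine le_trans (le_of_eq ?_) (sum_mul_potential_le (fun i : Fin N => X i) a
        (fun i => hw i) (fun i j => weight_le_two_mul X hcs i j) hm)
      refine Finset.sum_congr rfl fun i _ => ?_
      simp only [hG, dif_pos i.2, weight_append X hcs]

/-- The initial unit weights make the first choice uniform; the remaining k - 1 rounds start from
one hit cluster. -/
lemma measure_full_seeding_le {k : ℕ} (hk : 1 ≤ k) (hN : 1 ≤ N) (a : Fin N → Fin k) {c : ℝ}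
    (hc : 0 ≤ c) (B : Set Tape) :
    tapeMeasure {ω | c < cost X N (seeding X N fb [] k ω) ∧ ω.drop k ∈ B} ≤
      ENNReal.ofReal (4 * (1 + harmonic (k - 1)) * ∑ A, spread (fun i : Fin N => X i) a A) *
        ((ENNReal.ofReal c)⁻¹ * tapeMeasure B) := by
  obtain ⟨m, rfl⟩ : ∃ m, k = m + 1 := ⟨k - 1, by omega⟩
  have hsum : ∑ i ∈ Finset.range N, weight X ([] : List E) i = N := by simp [weight]
  have hN0 : (0 : ℝ) < N := by exact_mod_cast hN
  set G : ℕ → ℝ := fun i => if h : i < N then potential (fun i : Fin N => X i) a m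
    (fun j => weight X [X i] j) {a ⟨i, h⟩} else 0 with hG
  have hcard : ∀ A : Fin (m + 1), m ≤ ({A} : Finset (Fin (m + 1)))ᶜ.card := fun A => by
    simp [Finset.card_compl]
  have hG0 : ∀ i, 0 ≤ G i := by
    intro i
    simp only [hG]
    split_ifs with h
    · exact potential_nonneg _ _ (fun j => weight_nonneg X _ _) (hcard _)
    · exact le_rfl
  have hround := measure_round_le X N fb [] (by rw [hsum]; exact hN0)
    (fun p => {ω | c < cost X N (seeding X N fb [p] m ω) ∧ ω.drop m ∈ B}) G hG0
    ((ENNReal.ofReal c)⁻¹ * tapeMeasure B) fun i hi => by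
      simp only [hG, dif_pos hi]
      exact measure_seeding_le X N fb a hc B m (by simp) _ (hcard _)
  refine (le_trans (le_of_eq ?_) hround).trans ?_
  · congr 1
    ext ω
    simp only [Set.mem_ofPred_eq, seeding, Tape.drop_drop, Nat.add_comm 1 m, List.nil_append]
  · refine mul_le_mul_left (ENNReal.ofReal_le_ofReal ?_) _
    rw [hsum, div_le_iff₀ hN0, mul_comm, Finset.sum_range, Nat.add_sub_cancel]
    refine le_trans (le_of_eq ?_) ((sum_potential_singleton_le (fun i : Fin N => X i) a
      (by simp : m + 1 = _)).trans_eq (by simp))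
    refine Finset.sum_congr rfl fun i _ => ?_
    simp only [hG, dif_pos i.2, weight_singleton]
    simp [weight]

/-- The probability that `R` independent runs all miss twice the expected cost. -/
lemma measure_all_trials_le {k : ℕ} (hk : 1 ≤ k) (hN : 1 ≤ N) (a : Fin N → Fin k) (R : ℕ) :
    tapeMeasure {ω | ∀ r < R, 8 * (1 + harmonic (k - 1)) *
        ∑ A, spread (fun i : Fin N => X i) a A < cost X N (seeding X N fb [] k (ω.drop (r * k)))} ≤
      2⁻¹ ^ R := by
  set b : ℝ := 4 * (1 + harmonic (k - 1)) * ∑ A, spread (fun i : Fin N => X i) a A with hb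
  have hb0 : 0 ≤ b := by
    have := harmonic_cast_nonneg (k - 1)
    have := Finset.sum_nonneg fun A (_ : A ∈ Finset.univ) => spread_nonneg (fun i : Fin N => X i) a A
    positivity
  have h2b : 8 * (1 + harmonic (k - 1)) * ∑ A, spread (fun i : Fin N => X i) a A = 2 * b := by
    rw [hb]; ring
  rw [h2b]
  induction R with
  | zero => simp
  | succ R ih =>
    -- The first trial uses exactly k random numbers; the failure of the others is the event B about
    -- the remaining tape.
    have hsub : {ω : Tape | ∀ r < R + 1, 2 * b < cost X N (seeding X N fb [] k (ω.drop (r * k)))} ⊆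
        {ω : Tape | 2 * b < cost X N (seeding X N fb [] k ω) ∧ ω.drop k ∈
          {ω : Tape | ∀ r < R, 2 * b < cost X N (seeding X N fb [] k (ω.drop (r * k)))}} := by
      intro ω hω
      refine ⟨by simpa [Tape.drop_zero] using hω 0 (by omega), fun r hr => ?_⟩
      rw [Tape.drop_drop]
      have := hω (r + 1) (by omega)
      rwa [Nat.succ_mul, Nat.add_comm] at this
    refine (measure_mono hsub).trans ((measure_full_seeding_le X N fb hk hN a
      (by linarith : 0 ≤ 2 * b) _).trans ?_)
    rw [← hb, ← mul_assoc, pow_succ']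
    refine mul_le_mul' ?_ ih
    clear_value b
    rw [← div_eq_mul_inv]
    -- For b = 0 the quotient is 0/0 = 0 in `ENNReal`.
    rcases hb0.eq_or_lt with h | h
    · simp [← h]
    · rw [ENNReal.div_le_iff (by simp [h]) ENNReal.ofReal_ne_top, ENNReal.ofReal_mul (by norm_num), ← mul_assoc,
        ENNReal.ofReal_ofNat, ENNReal.inv_mul_cancel (by simp) (by simp), one_mul]

end Seeding

end SegClust

end

noncomputable section

namespace SegClust

/-! ### A program logic with time bounds -/

section Logic

/-- Big-step execution: the program halts after exactly `t` steps. -/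
inductive Run (ω : Tape) : Program → State → ℕ → State → Prop
  | instr (a : Instr) (s : State) : Run ω (.instr a) s 1 (a.exec ω s)
  | seq {p q : Program} {s s₁ s₂ : State} {t₁ t₂ : ℕ} :
      Run ω p s t₁ s₁ → Run ω q s₁ t₂ s₂ → Run ω (.seq p q) s (t₂ + t₁ + 1) s₂
  | ite_true {b : Test} {p q : Program} {s s' : State} {t : ℕ} :
      b.Holds s → Run ω p s t s' → Run ω (.ite b p q) s (t + 1) s'
  | ite_false {b : Test} {p q : Program} {s s' : State} {t : ℕ} :
      ¬ b.Holds s → Run ω q s t s' → Run ω (.ite b p q) s (t + 1) s'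
  | loop_exit {b : Test} {p : Program} {s : State} : ¬ b.Holds s → Run ω (.loop b p) s 1 s
  | loop_step {b : Test} {p : Program} {s s₁ s₂ : State} {t₁ t₂ : ℕ} :
      b.Holds s → Run ω p s t₁ s₁ → Run ω (.loop b p) s₁ t₂ s₂ →
      Run ω (.loop b p) s (t₂ + t₁ + 1) s₂

/-- The continuation K must be arbitrary for the induction, since subprograms run with further parts
waiting. The order t₂ + t₁ + 1 in `Run` is the one that `Function.iterate_add_apply` unfolds. -/
lemma Run.step_iterate {ω : Tape} {p : Program} {s s' : State} {t : ℕ} (h : Run ω p s t s')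
    (K : List Program) : (step ω)^[t] (p :: K, s) = (K, s') := by
  induction h generalizing K with
  | instr a s => rfl
  | seq _ _ ih₁ ih₂ =>
    rw [Function.iterate_succ_apply, Function.iterate_add_apply]
    simp only [step]
    rw [ih₁, ih₂]
  | ite_true hb _ ih =>
    rw [Function.iterate_succ_apply]
    simp only [step, if_pos hb]
    exact ih K
  | ite_false hb _ ih =>
    rw [Function.iterate_succ_apply]
    simp only [step, if_neg hb]
    exact ih K
  | loop_exit hb => simp [step, hb]
  | loop_step hb _ _ ih₁ ih₂ =>
    rw [Function.iterate_succ_apply, Function.iterate_add_apply]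
    simp only [step, if_pos hb]
    rw [ih₁, ih₂]

/-- Whether an instruction overwrites a given natural register. -/
def Instr.writesNat (i : ℕ) : Instr → Bool
  | .natConst j _ | .natAdd j _ _ | .natSub j _ _ | .natLoad j _ _ => i == j
  | _ => false

/-- Whether an instruction overwrites a given real register. -/
def Instr.writesReal (i : ℕ) : Instr → Bool
  | .realConst j _ | .realOfNat j _ | .realAdd j _ _ | .realSub j _ _ | .realMul j _ _
  | .realDiv j _ _ | .realLoad j _ _ | .random j => i == j
  | _ => false

/-- Whether an instruction stores into a given real array. -/
def Instr.writesArr (a : ℕ) : Instr → Bool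
  | .realStore b _ _ => a == b
  | _ => false

/-- Whether an instruction uses the random source. -/
def Instr.usesRandom : Instr → Bool
  | .random _ => true
  | _ => false

/-- Whether some instruction of a program has a given property. -/
def Program.any (f : Instr → Bool) : Program → Bool
  | .instr a => f a
  | .seq p q | .ite _ p q => p.any f || q.any f
  | .loop _ p => p.any f

/-- A program changes only the registers and arrays that it mentions as targets. -/
structure Frame (p : Program) (s s' : State) : Prop where
  nat : ∀ i, p.any (Instr.writesNat i) = false → s'.natReg i = s.natReg i
  real : ∀ i, p.any (Instr.writesReal i) = false → s'.realReg i = s.realReg i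
  arr : ∀ a, p.any (Instr.writesArr a) = false → s'.realArr a = s.realArr a
  used : p.any Instr.usesRandom = false → s'.used = s.used

lemma Frame.refl (p : Program) (s : State) : Frame p s s :=
  ⟨fun _ _ => rfl, fun _ _ => rfl, fun _ _ => rfl, fun _ => rfl⟩

lemma Frame.trans {p : Program} {s s₁ s₂ : State} (h₁ : Frame p s s₁) (h₂ : Frame p s₁ s₂) :
    Frame p s s₂ :=
  ⟨fun i h => (h₂.nat i h).trans (h₁.nat i h), fun i h => (h₂.real i h).trans (h₁.real i h),
    fun a h => (h₂.arr a h).trans (h₁.arr a h), fun h => (h₂.used h).trans (h₁.used h)⟩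

lemma Frame.mono {p q : Program} {s s' : State} (h : Frame p s s')
    (hpq : ∀ f, q.any f = false → p.any f = false) : Frame q s s' :=
  ⟨fun i hi => h.nat i (hpq _ hi), fun i hi => h.real i (hpq _ hi),
    fun a ha => h.arr a (hpq _ ha), fun hu => h.used (hpq _ hu)⟩

lemma Instr.frame (ω : Tape) (a : Instr) (s : State) : Frame (.instr a) s (a.exec ω s) := by
  refine ⟨fun i h => ?_, fun i h => ?_, fun b h => ?_, fun h => ?_⟩ <;>
  cases a <;>
  simp_all [Program.any, Instr.writesNat, Instr.writesReal, Instr.writesArr, Instr.usesRandom,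
    Instr.exec, State.setNat, State.setReal]

/-- For concrete programs the side conditions of `Frame` hold by `rfl`, so the specifications below
need to mention only what changes. -/
lemma Run.frame {ω : Tape} {p : Program} {s s' : State} {t : ℕ} (h : Run ω p s t s') :
    Frame p s s' := by
  induction h with
  | instr a s => exact a.frame ω s
  | seq _ _ ih₁ ih₂ =>
    refine (ih₁.mono fun f hf => ?_).trans (ih₂.mono fun f hf => ?_) <;> simp_all [Program.any]
  | ite_true _ _ ih => exact ih.mono fun f hf => by simp_all [Program.any]
  | ite_false _ _ ih => exact ih.mono fun f hf => by simp_all [Program.any]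
  | loop_exit _ => exact Frame.refl _ _
  | loop_step _ _ _ ih₁ ih₂ => exact (ih₁.mono (q := .loop _ _) fun f hf => hf).trans ih₂

/-- Started in state `s`, the program halts within `T` steps in a state that satisfies `Q`. -/
def Ex (ω : Tape) (p : Program) (T : ℕ) (s : State) (Q : State → Prop) : Prop :=
  ∃ t ≤ T, ∃ s', Run ω p s t s' ∧ Q s'

variable {ω : Tape} {p q : Program} {s : State} {T T₁ T₂ : ℕ} {Q Q' : State → Prop}

lemma Ex.mono (h : Ex ω p T₁ s Q) (hT : T₁ ≤ T₂) (hQ : ∀ s', Frame p s s' → Q s' → Q' s') :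
    Ex ω p T₂ s Q' := by
  obtain ⟨t, ht, s', hr, hq⟩ := h
  exact ⟨t, ht.trans hT, s', hr, hQ s' hr.frame hq⟩

lemma Ex.seq (h₁ : Ex ω p T₁ s Q') (h₂ : ∀ s₁, Frame p s s₁ → Q' s₁ → Ex ω q T₂ s₁ Q) :
    Ex ω (.seq p q) (T₂ + T₁ + 1) s Q := by
  obtain ⟨t₁, ht₁, s₁, hr₁, hq₁⟩ := h₁
  obtain ⟨t₂, ht₂, s₂, hr₂, hq₂⟩ := h₂ s₁ hr₁.frame hq₁
  exact ⟨_, by omega, s₂, hr₁.seq hr₂, hq₂⟩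

lemma Ex.ite {b : Test} (h₁ : b.Holds s → Ex ω p T s Q) (h₂ : ¬ b.Holds s → Ex ω q T s Q) :
    Ex ω (.ite b p q) (T + 1) s Q := by
  by_cases hb : b.Holds s
  · obtain ⟨t, ht, s', hr, hq⟩ := h₁ hb
    exact ⟨_, by omega, s', .ite_true hb hr, hq⟩
  · obtain ⟨t, ht, s', hr, hq⟩ := h₂ hb
    exact ⟨_, by omega, s', .ite_false hb hr, hq⟩

/-- The invariant is indexed by the number of completed iterations, which fixes the iteration count.
Each iteration also gets a frame back to the state before the loop. -/
lemma Ex.loop {b : Test} (Inv : ℕ → State → Prop) (N : ℕ) (h0 : Inv 0 s)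
    (hstep : ∀ m < N, ∀ s₁, Frame p s s₁ → Inv m s₁ → b.Holds s₁ ∧ Ex ω p T s₁ (Inv (m + 1)))
    (hexit : ∀ s₁, Frame p s s₁ → Inv N s₁ → ¬ b.Holds s₁) :
    Ex ω (.loop b p) (N * (T + 1) + 1) s (Inv N) := by
  suffices h : ∀ j m s₁, m + j = N → Frame p s s₁ → Inv m s₁ →
      Ex ω (.loop b p) (j * (T + 1) + 1) s₁ (Inv N) from h N 0 s (by omega) (Frame.refl _ _) h0
  intro j
  induction j with
  | zero =>
    intro m s₁ hm hF hI
    obtain rfl : m = N := by omega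
    exact ⟨1, by omega, s₁, .loop_exit (hexit s₁ hF hI), hI⟩
  | succ j ih =>
    intro m s₁ hm hF hI
    obtain ⟨hb, t₁, ht₁, s₂, hr₁, hI₂⟩ := hstep m (by omega) s₁ hF hI
    obtain ⟨t₂, ht₂, s₃, hr₂, hI₃⟩ := ih (m + 1) s₂ (by omega) (hF.trans hr₁.frame) hI₂
    refine ⟨_, ?_, s₃, .loop_step hb hr₁ hr₂, hI₃⟩
    rw [Nat.succ_mul]
    omega

/-- Straight-line code. -/
def block (a : Instr) : List Instr → Program
  | [] => .instr a
  | b :: l => .seq (.instr a) (block b l)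

/-- There are `l.length + 1` instructions and `l.length` sequencing steps. -/
lemma Ex.block {a : Instr} {l : List Instr} (h : Q ((a :: l).foldl (fun s a => a.exec ω s) s)) :
    Ex ω (block a l) (2 * l.length + 1) s Q := by
  induction l generalizing a s with
  | nil => exact ⟨1, le_rfl, _, .instr a s, h⟩
  | cons b l ih =>
    obtain ⟨t, ht, s', hr, hq⟩ := ih (a := b) (s := a.exec ω s) h
    exact ⟨_, by simp only [List.length_cons]; omega, s', .seq (.instr a s) hr, hq⟩

end Logic

end SegClust

end

noncomputable section

namespace SegClust

/-! ### The program -/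

section Program

/-- The instruction that does nothing useful. -/
def skip : Program := .instr (.natConst 16 0)

/-- `R 9 := R 9 + ∑ j, (B_5 [N 11 + j] - B_3 [N 15 + j])²`; advances the pointers. -/
def distLoop : Program :=
  .loop (.natLt 10 0) (block (.realLoad 7 5 11) [.realLoad 8 3 15, .realSub 7 7 8, .realMul 7 7 7,
    .realAdd 9 9 7, .natAdd 11 11 3, .natAdd 15 15 3, .natAdd 10 10 3])

/-- Replace the weights by the squared distances to the new centre if these are smaller. -/
def updateBody : Program :=
  .seq (block (.natConst 10 0) [.natAdd 15 13 4, .realConst 9 0])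
    (.seq distLoop
      -- `N 12` counts the centres. For the first one the stored weight is the artificial 1, which
      -- must be replaced and not minimised with.
      (.seq (.ite (.natLt 4 12) (.seq (.instr (.realLoad 7 4 8))
          (.ite (.realLt 9 7) skip (.instr (.realAdd 9 7 14)))) skip)
        (block (.realStore 4 8 9) [.realAdd 3 3 9, .natAdd 8 8 3])))

/-- Recompute the weights and their sum. -/
def updatePass : Program :=
  .seq (block (.natConst 8 0) [.natConst 11 0, .realConst 3 0]) (.loop (.natLt 8 7) updateBody)

/-- Find the sampled point. -/
def scanPass : Program :=
  .seq (block (.natConst 8 0) [.natConst 14 0, .realConst 5 0])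
    (.loop (.natLt 8 7) (.seq (block (.realLoad 7 4 8) [.realAdd 5 5 7])
      -- Without multiplication of naturals, the selected index is accumulated in steps of d,
      -- directly as a cell address.
      (.seq (.ite (.realLt 4 5) skip (.instr (.natAdd 14 14 0))) (.instr (.natAdd 8 8 3)))))

/-- Append the sampled point or the fallback point to the centres. -/
def copyPass : Program :=
  .seq (block (.natConst 10 0) [.natAdd 15 13 4])
    -- `N 6` is N d, so an address below it means that a point was selected.
    (.loop (.natLt 10 0) (.seq (.ite (.natLt 14 6) (.instr (.realLoad 7 5 14))
      (.instr (.realAdd 7 6 14))) (block (.realStore 3 15 7)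
        [.natAdd 14 14 3, .natAdd 15 15 3, .natAdd 10 10 3])))

/-- One round of the seeding. -/
def roundProg : Program :=
  .seq (block (.random 4) [.realMul 4 4 3])
    (.seq scanPass (.seq copyPass
      (.seq (block (.realLoad 7 3 13) [.realMul 7 7 7, .realAdd 6 6 7, .realAdd 6 6 11])
        (.seq updatePass (block (.natAdd 13 13 0) [.natAdd 12 12 3])))))

/-- One run of the seeding. -/
def trialProg : Program :=
  .seq (.instr (.natConst 8 0))
    (.seq (.loop (.natLt 8 7) (block (.realStore 4 8 11) [.natAdd 8 8 3]))
      (.seq (block (.realOfNat 3 7) [.realConst 6 1, .natConst 12 0, .natConst 13 0])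
        (.loop (.natLt 12 2) roundProg)))

/-- Make the current centres the output. -/
def saveProg : Program :=
  .seq (.instr (.natConst 8 0))
    (.seq (.loop (.natLt 8 13) (block (.realLoad 7 3 8) [.realStore 2 8 7, .natAdd 8 8 3]))
      (.instr (.realAdd 10 3 14)))

/-- Run trials and keep the best one. -/
def mainLoop : Program :=
  .loop (.realLt 1 2) (.seq trialProg
    -- `R 2` is 2^(-m) after m trials; it equals 1 exactly in the first trial, when there is nothing
    -- to compare with.
    (.seq (.ite (.realLt 2 11) (.ite (.realLt 3 10) saveProg skip) saveProg)
      (.instr (.realDiv 2 2 13))))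

/-- Write the coordinates of one grid point. -/
def gridPointLoop : Program :=
  .loop (.natLt 10 0) (block (.realLoad 8 1 14) [.realMul 8 7 8, .realLoad 9 0 14, .realAdd 8 9 8,
    .realStore 5 11 8, .natAdd 14 14 3, .natAdd 11 11 3, .natAdd 10 10 3])

/-- Write the grid points of one segment. -/
def gridSegmentLoop : Program :=
  .loop (.natLt 9 5) (.seq (block (.natConst 10 0) [.natAdd 14 13 4, .realOfNat 7 9,
    .realDiv 7 7 12]) (.seq gridPointLoop (block (.natAdd 9 9 3) [.natAdd 7 7 3])))

/-- Write the grid points of all segments. -/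
def gridProg : Program :=
  .loop (.natLt 8 1) (.seq (.instr (.natConst 9 0)) (.seq gridSegmentLoop
    (block (.natAdd 13 13 0) [.natAdd 8 8 3])))

/-- The whole program. -/
def clusterProg : Program :=
  -- `N 3` = 1 is the increment, `N 5` and `R 12` hold 2k, `R 11` and `R 13` hold 1 and 2. The zeros
  -- in `N 4` and `R 14` come from the initial memory and serve for copying by addition.
  .seq (block (.natConst 3 1) [.natAdd 5 2 2, .realConst 11 1, .realOfNat 12 5, .realConst 13 2,
    .realConst 2 1])
    (.seq gridProg (.seq (.instr (.natAdd 6 11 4)) mainLoop))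

variable {ω : Tape} {s : State}

lemma distLoop_spec {d P C : ℕ} (h0 : s.natReg 0 = d) (h3 : s.natReg 3 = 1)
    (h10 : s.natReg 10 = 0) (h11 : s.natReg 11 = P) (h15 : s.natReg 15 = C)
    (h9 : s.realReg 9 = 0) :
    Ex ω distLoop (16 * d + 1) s fun s' => s'.natReg 11 = P + d ∧
      s'.realReg 9 = ∑ j ∈ Finset.range d, (s.realArr 5 (P + j) - s.realArr 3 (C + j)) ^ 2 := by
  refine (Ex.loop (fun m s' => s'.natReg 10 = m ∧ s'.natReg 11 = P + m ∧ s'.natReg 15 = C + m ∧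
    s'.realReg 9 = ∑ j ∈ Finset.range m, (s.realArr 5 (P + j) - s.realArr 3 (C + j)) ^ 2) d
    (by simp [*]) ?_ ?_).mono (T₁ := d * (15 + 1) + 1) (by omega) ?_
  · rintro m hm s₁ hF ⟨i10, i11, i15, i9⟩
    have e0 := hF.nat 0 rfl
    have e3 := hF.nat 3 rfl
    have a5 := hF.arr 5 rfl
    have a3 := hF.arr 3 rfl
    refine ⟨by simp [Test.Holds, *], Ex.block ?_⟩
    simp [Instr.exec, State.setNat, State.setReal, Finset.sum_range_succ, *]
    refine ⟨by omega, by omega, by ring⟩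
  · rintro s₁ hF ⟨i10, -⟩
    simp [Test.Holds, hF.nat 0 rfl, *]
  · rintro s' - ⟨-, i11, -, i9⟩
    exact ⟨i11, i9⟩

/-- The new weight of the point that starts at cell `P`, with the new centre at cell `C`. -/
def newWeight (s : State) (d t C P i : ℕ) : ℝ :=
  if 0 < t then min (s.realArr 4 i)
    (∑ j ∈ Finset.range d, (s.realArr 5 (P + j) - s.realArr 3 (C + j)) ^ 2)
  else ∑ j ∈ Finset.range d, (s.realArr 5 (P + j) - s.realArr 3 (C + j)) ^ 2

lemma updateBody_spec {d t C P i : ℕ} (h0 : s.natReg 0 = d) (h3 : s.natReg 3 = 1)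
    (h4 : s.natReg 4 = 0) (h8 : s.natReg 8 = i) (h11 : s.natReg 11 = P) (h12 : s.natReg 12 = t)
    (h13 : s.natReg 13 = C) (h14 : s.realReg 14 = 0) :
    Ex ω updateBody (16 * d + 20) s fun s' => s'.natReg 8 = i + 1 ∧ s'.natReg 11 = P + d ∧
      s'.realReg 3 = s.realReg 3 + newWeight s d t C P i ∧
      s'.realArr 4 = Function.update (s.realArr 4) i (newWeight s d t C P i) := by
  refine (Ex.seq (T₁ := 5) (T₂ := 16 * d + 14) (Ex.block (Q := fun s' => s'.natReg 10 = 0 ∧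
    s'.natReg 15 = C ∧ s'.realReg 9 = 0)
    (by simp [Instr.exec, State.setNat, State.setReal, *])) ?_).mono (by omega) fun _ _ h => h
  rintro s₁ hF₁ ⟨i10, i15, i9⟩
  refine (Ex.seq (T₂ := 12) (distLoop_spec (d := d) (P := P) (C := C) ((hF₁.nat 0 rfl).trans h0)
    ((hF₁.nat 3 rfl).trans h3) i10 ((hF₁.nat 11 rfl).trans h11) i15 i9) ?_).mono
    (by omega) fun _ _ h => h
  rintro s₂ hF₂ ⟨j11, j9⟩
  rw [hF₁.arr 3 rfl, hF₁.arr 5 rfl] at j9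
  have e4 : s₂.realArr 4 = s.realArr 4 := (hF₂.arr 4 rfl).trans (hF₁.arr 4 rfl)
  have e14 : s₂.realReg 14 = 0 := ((hF₂.real 14 rfl).trans (hF₁.real 14 rfl)).trans h14
  have e3 : s₂.realReg 3 = s.realReg 3 := (hF₂.real 3 rfl).trans (hF₁.real 3 rfl)
  have n3 : s₂.natReg 3 = 1 := ((hF₂.nat 3 rfl).trans (hF₁.nat 3 rfl)).trans h3
  have n4 : s₂.natReg 4 = 0 := ((hF₂.nat 4 rfl).trans (hF₁.nat 4 rfl)).trans h4
  have n8 : s₂.natReg 8 = i := ((hF₂.nat 8 rfl).trans (hF₁.nat 8 rfl)).trans h8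
  have n12 : s₂.natReg 12 = t := ((hF₂.nat 12 rfl).trans (hF₁.nat 12 rfl)).trans h12
  refine (Ex.seq (T₁ := 6) (T₂ := 5) (Q' := fun s' => s'.realReg 9 = newWeight s d t C P i)
    ?_ ?_).mono (by omega) fun _ _ h => h
  · refine Ex.ite (T := 5) (fun hb => ?_) fun hb => ?_
    · have ht : 0 < t := by simpa [Test.Holds, n4, n12] using hb
      refine (Ex.seq (T₁ := 1) (T₂ := 3) (Q' := fun s' => s'.realReg 7 = s.realArr 4 i)
        ⟨1, le_rfl, _, .instr _ _, by simp [Instr.exec, State.setReal, *]⟩ ?_).mono (by omega)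
        fun _ _ h => h
      rintro s₃ hF₃ k7
      have k9 := (hF₃.real 9 rfl).trans j9
      have k14 := (hF₃.real 14 rfl).trans e14
      refine (Ex.ite (T := 1) (fun hb => ⟨1, le_rfl, _, .instr _ _, ?_⟩)
        fun hb => ⟨1, le_rfl, _, .instr _ _, ?_⟩).mono (by omega) fun _ _ h => h
      · simp only [Test.Holds, k9, k7] at hb
        simp [Instr.exec, State.setNat, newWeight, ht, k9, min_eq_right hb.le]
      · simp only [Test.Holds, k9, k7, not_lt] at hb
        simp [Instr.exec, State.setReal, newWeight, ht, k7, k14, min_eq_left hb]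
    · have ht : ¬ 0 < t := by simpa [Test.Holds, n4, n12] using hb
      exact ⟨1, by omega, _, .instr _ _, by
        rw [newWeight, if_neg ht]; simp [Instr.exec, State.setNat, *]⟩
  · rintro s₃ hF₃ k9
    have m3 := (hF₃.nat 3 rfl).trans n3
    have m8 := (hF₃.nat 8 rfl).trans n8
    have m11 := (hF₃.nat 11 rfl).trans j11
    have r3 := (hF₃.real 3 rfl).trans e3
    have a4 := (hF₃.arr 4 rfl).trans e4
    refine Ex.block ?_
    simp [Instr.exec, State.setNat, State.setReal, *]

lemma updatePass_spec {d t C N : ℕ} (hd : 1 ≤ d) (h0 : s.natReg 0 = d) (h3 : s.natReg 3 = 1)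
    (h4 : s.natReg 4 = 0) (h7 : s.natReg 7 = N) (h12 : s.natReg 12 = t) (h13 : s.natReg 13 = C)
    (h14 : s.realReg 14 = 0) :
    Ex ω updatePass (37 * (N * d) + 7) s fun s' =>
      s'.realReg 3 = ∑ i ∈ Finset.range N, newWeight s d t C (i * d) i ∧
      ∀ i < N, s'.realArr 4 i = newWeight s d t C (i * d) i := by
  refine (Ex.seq (T₁ := 5) (T₂ := N * (16 * d + 20 + 1) + 1) (Ex.block (Q := fun s' =>
    s'.natReg 8 = 0 ∧ s'.natReg 11 = 0 ∧ s'.realReg 3 = 0)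
    (by simp [Instr.exec, State.setNat, State.setReal])) ?_).mono ?_ fun _ _ h => h
  · rintro s₁ hF₁ ⟨i8, i11, i3⟩
    refine (Ex.loop (fun m s' => s'.natReg 8 = m ∧ s'.natReg 11 = m * d ∧
      s'.realReg 3 = ∑ i ∈ Finset.range m, newWeight s d t C (i * d) i ∧
      (∀ i < m, s'.realArr 4 i = newWeight s d t C (i * d) i) ∧
      -- Cells not yet visited keep the old weights, which `newWeight` at the original state refers
      -- to.
      ∀ i, m ≤ i → s'.realArr 4 i = s.realArr 4 i) N ?_ ?_ ?_).mono le_rfl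
        fun s' _ h => ⟨h.2.2.1, h.2.2.2.1⟩
    · simp [i8, i11, i3, hF₁.arr 4 rfl]
    · rintro m hm s₂ hF₂ ⟨j8, j11, j3, jlt, jge⟩
      refine ⟨by simp [Test.Holds, hF₂.nat 7 rfl, hF₁.nat 7 rfl, h7, j8, hm], ?_⟩
      have hnw : newWeight s₂ d t C (m * d) m = newWeight s d t C (m * d) m := by
        unfold newWeight
        rw [hF₂.arr 5 rfl, hF₁.arr 5 rfl, hF₂.arr 3 rfl, hF₁.arr 3 rfl, jge m le_rfl]
      refine (updateBody_spec (d := d) (t := t) (C := C) (P := m * d) (i := m) ?_ ?_ ?_ j8 j11 ?_ ?_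
        ?_).mono le_rfl ?_
      · rw [hF₂.nat 0 rfl, hF₁.nat 0 rfl, h0]
      · rw [hF₂.nat 3 rfl, hF₁.nat 3 rfl, h3]
      · rw [hF₂.nat 4 rfl, hF₁.nat 4 rfl, h4]
      · rw [hF₂.nat 12 rfl, hF₁.nat 12 rfl, h12]
      · rw [hF₂.nat 13 rfl, hF₁.nat 13 rfl, h13]
      · rw [hF₂.real 14 rfl, hF₁.real 14 rfl, h14]
      · rintro s₃ - ⟨k8, k11, k3, k4⟩
        rw [hnw] at k3 k4
        refine ⟨k8, by rw [k11, Nat.succ_mul], by rw [k3, j3, Finset.sum_range_succ], ?_, ?_⟩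
        · intro i hi
          rw [k4]
          rcases Nat.lt_succ_iff_lt_or_eq.1 hi with h | rfl
          · rw [Function.update_of_ne h.ne, jlt i h]
          · rw [Function.update_self]
        · intro i hi
          rw [k4, Function.update_of_ne (by omega), jge i (by omega)]
    · rintro s₂ hF₂ ⟨j8, -⟩
      simp [Test.Holds, hF₂.nat 7 rfl, hF₁.nat 7 rfl, h7, j8]
  · nlinarith [Nat.mul_le_mul_left N hd]

lemma scanPass_spec {d N : ℕ} (hd : 1 ≤ d) (h0 : s.natReg 0 = d) (h3 : s.natReg 3 = 1)
    (h7 : s.natReg 7 = N) :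
    Ex ω scanPass (9 * (N * d) + 7) s fun s' =>
      s'.natReg 14 = chooseIdx (s.realArr 4) N (s.realReg 4) * d := by
  refine (Ex.seq (T₁ := 5) (T₂ := N * 9 + 1) (Ex.block (Q := fun s' =>
    s'.natReg 8 = 0 ∧ s'.natReg 14 = 0 ∧ s'.realReg 5 = 0)
    (by simp [Instr.exec, State.setNat, State.setReal])) ?_).mono ?_ fun _ _ h => h
  · rintro s₁ hF₁ ⟨i8, i14, i5⟩
    refine (Ex.loop (T := 8) (fun m s' => s'.natReg 8 = m ∧
      s'.realReg 5 = ∑ i ∈ Finset.range m, s.realArr 4 i ∧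
      s'.natReg 14 = chooseIdx (s.realArr 4) m (s.realReg 4) * d) N ?_ ?_ ?_).mono le_rfl
        fun s' _ h => h.2.2
    · simp [i8, i14, i5, chooseIdx]
    · rintro m hm s₂ hF₂ ⟨j8, j5, j14⟩
      refine ⟨by simp [Test.Holds, hF₂.nat 7 rfl, hF₁.nat 7 rfl, h7, j8, hm], ?_⟩
      have a4 : s₂.realArr 4 = s.realArr 4 := (hF₂.arr 4 rfl).trans (hF₁.arr 4 rfl)
      refine (Ex.seq (T₁ := 3) (T₂ := 4) (Ex.block (Q := fun s' =>
        s'.realReg 5 = ∑ i ∈ Finset.range (m + 1), s.realArr 4 i)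
        (by simp [Instr.exec, State.setReal, Finset.sum_range_succ, *])) ?_).mono le_rfl
        fun _ _ h => h
      rintro s₃ hF₃ k5
      have k4 : s₃.realReg 4 = s.realReg 4 :=
        ((hF₃.real 4 rfl).trans (hF₂.real 4 rfl)).trans (hF₁.real 4 rfl)
      have k14 := (hF₃.nat 14 rfl).trans j14
      have k0 : s₃.natReg 0 = d :=
        (((hF₃.nat 0 rfl).trans (hF₂.nat 0 rfl)).trans (hF₁.nat 0 rfl)).trans h0
      refine (Ex.seq (T₁ := 2) (T₂ := 1) (Q' := fun s' =>
        s'.natReg 14 = chooseIdx (s.realArr 4) (m + 1) (s.realReg 4) * d) ?_ ?_).mono le_rfl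
        fun _ _ h => h
      · refine Ex.ite (T := 1) (fun hb => ⟨1, le_rfl, _, .instr _ _, ?_⟩)
          fun hb => ⟨1, le_rfl, _, .instr _ _, ?_⟩
        · simp only [Test.Holds, k4, k5] at hb
          rw [chooseIdx_succ, if_neg (not_le.2 hb)]
          simp [Instr.exec, State.setNat, k14]
        · simp only [Test.Holds, k4, k5, not_lt] at hb
          rw [chooseIdx_succ, if_pos hb, Nat.succ_mul]
          simp [Instr.exec, State.setNat, k14, k0]
      · rintro s₄ hF₄ l14
        refine ⟨1, le_rfl, _, .instr _ _, ?_⟩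
        have l8 := (hF₄.nat 8 rfl).trans ((hF₃.nat 8 rfl).trans j8)
        have l3 : s₄.natReg 3 = 1 := (hF₄.nat 3 rfl).trans
          (((hF₃.nat 3 rfl).trans (hF₂.nat 3 rfl)).trans ((hF₁.nat 3 rfl).trans h3))
        have l5 := (hF₄.real 5 rfl).trans k5
        simp [Instr.exec, State.setNat, *]
    · rintro s₂ hF₂ ⟨j8, -⟩
      simp [Test.Holds, hF₂.nat 7 rfl, hF₁.nat 7 rfl, h7, j8]
  · nlinarith [Nat.mul_le_mul_left N hd]

lemma copyPass_spec {d C E : ℕ} (h0 : s.natReg 0 = d) (h3 : s.natReg 3 = 1) (h4 : s.natReg 4 = 0)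
    (h6 : s.natReg 6 = E) (h13 : s.natReg 13 = C) (h14 : s.realReg 14 = 0) :
    Ex ω copyPass (11 * d + 5) s fun s' =>
      (∀ j < d, s'.realArr 3 (C + j) = if s.natReg 14 + j < E then
        s.realArr 5 (s.natReg 14 + j) else s.realReg 6) ∧
      ∀ x < C, s'.realArr 3 x = s.realArr 3 x := by
  refine (Ex.seq (T₁ := 3) (T₂ := d * 11 + 1) (Ex.block (Q := fun s' =>
    s'.natReg 10 = 0 ∧ s'.natReg 15 = C)
    (by simp [Instr.exec, State.setNat, *])) ?_).mono (by omega) fun _ _ h => h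
  rintro s₁ hF₁ ⟨i10, i15⟩
  refine (Ex.loop (T := 10) (fun m s' => s'.natReg 10 = m ∧ s'.natReg 15 = C + m ∧
    s'.natReg 14 = s.natReg 14 + m ∧
    (∀ j < m, s'.realArr 3 (C + j) = if s.natReg 14 + j < E then
        s.realArr 5 (s.natReg 14 + j) else s.realReg 6) ∧
      ∀ x < C, s'.realArr 3 x = s.realArr 3 x) d ?_ ?_ ?_).mono le_rfl fun s' _ h => h.2.2.2
  · simp [i10, i15, hF₁.nat 14 rfl, hF₁.arr 3 rfl]
  · rintro m hm s₂ hF₂ ⟨j10, j15, j14, jlt, jx⟩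
    refine ⟨by simp [Test.Holds, hF₂.nat 0 rfl, hF₁.nat 0 rfl, h0, j10, hm], ?_⟩
    have a5 : s₂.realArr 5 = s.realArr 5 := (hF₂.arr 5 rfl).trans (hF₁.arr 5 rfl)
    have n6 : s₂.natReg 6 = E := ((hF₂.nat 6 rfl).trans (hF₁.nat 6 rfl)).trans h6
    have n3 : s₂.natReg 3 = 1 := ((hF₂.nat 3 rfl).trans (hF₁.nat 3 rfl)).trans h3
    have r6 : s₂.realReg 6 = s.realReg 6 := (hF₂.real 6 rfl).trans (hF₁.real 6 rfl)
    have r14 : s₂.realReg 14 = 0 := ((hF₂.real 14 rfl).trans (hF₁.real 14 rfl)).trans h14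
    refine (Ex.seq (T₁ := 2) (T₂ := 7) (Q' := fun s' => s'.realReg 7 =
      if s.natReg 14 + m < E then s.realArr 5 (s.natReg 14 + m) else s.realReg 6) ?_ ?_).mono
      le_rfl fun _ _ h => h
    · refine Ex.ite (T := 1) (fun hb => ⟨1, le_rfl, _, .instr _ _, ?_⟩)
          fun hb => ⟨1, le_rfl, _, .instr _ _, ?_⟩
      · simp only [Test.Holds, j14, n6] at hb
        simp [Instr.exec, State.setReal, *]
      · simp only [Test.Holds, j14, n6] at hb
        simp [Instr.exec, State.setReal, *]
    · rintro s₃ hF₃ k7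
      have k10 := (hF₃.nat 10 rfl).trans j10
      have k14 := (hF₃.nat 14 rfl).trans j14
      have k15 := (hF₃.nat 15 rfl).trans j15
      have k3 := (hF₃.nat 3 rfl).trans n3
      have a3 := hF₃.arr 3 rfl
      refine Ex.block ?_
      simp only [List.foldl_cons, List.foldl_nil, Instr.exec, State.setNat]
      refine ⟨by simp [*], by simp [*, Nat.add_assoc], by simp [*, Nat.add_assoc], ?_, ?_⟩
      · intro j hj
        rcases Nat.lt_succ_iff_lt_or_eq.1 hj with h | rfl
        · simp [k15, a3, h.ne, jlt j h]
        · simp [k15, k7]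
      · intro x hx
        have : x ≠ C + m := by omega
        simp [k15, a3, this, jx x hx]
  · rintro s₂ hF₂ ⟨j10, -⟩
    simp [Test.Holds, hF₂.nat 0 rfl, hF₁.nat 0 rfl, h0, j10]

end Program

end SegClust

end

noncomputable section

namespace SegClust

/-! ### The program implements the seeding -/

section Verification

/-- A coordinate of the fallback point, larger than the first coordinates of all centres. -/
def fallbackValue {d : ℕ} (cs : List (EuclideanSpace ℝ (Fin d))) : ℝ :=
  1 + (cs.map fun c => coords c 0 ^ 2 + 1).sum

/-- A point that differs from all centres. -/
def fallback {d : ℕ} (cs : List (EuclideanSpace ℝ (Fin d))) : EuclideanSpace ℝ (Fin d) :=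
  WithLp.toLp 2 fun _ => fallbackValue cs

/-- If the fallback value x were the first coordinate of a centre, the sum x - 1 would contain the
summand x² + 1, but x² + 1 > x - 1. -/
lemma fallback_notMem {d : ℕ} (hd : 1 ≤ d) (cs : List (EuclideanSpace ℝ (Fin d))) :
    fallback cs ∉ cs := by
  intro h
  have h1 : coords (fallback cs) 0 ^ 2 + 1 ≤ (cs.map fun c => coords c 0 ^ 2 + 1).sum := by
    refine List.single_le_sum (fun x hx => ?_) _ (List.mem_map.2 ⟨_, h, rfl⟩)
    obtain ⟨c, -, rfl⟩ := List.mem_map.1 hx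
    positivity
  have h2 : coords (fallback cs) 0 = fallbackValue cs := by
    simp [coords, fallback, show 0 < d by omega]
  rw [h2] at h1
  have h3 : fallbackValue cs = 1 + (cs.map fun c => coords c 0 ^ 2 + 1).sum := rfl
  nlinarith [sq_nonneg (fallbackValue cs - 1), sq_nonneg (fallbackValue cs)]

/-- Needed because `RoundInv` controls only the first N cells of the weight array. -/
lemma chooseIdx_congr {w w' : ℕ → ℝ} {N : ℕ} (h : ∀ i < N, w i = w' i) (r : ℝ) :
    chooseIdx w N r = chooseIdx w' N r := by
  induction N with
  | zero => rfl
  | succ N ih =>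
    have h1 : ∑ m ∈ Finset.range (N + 1), w m = ∑ m ∈ Finset.range (N + 1), w' m :=
      Finset.sum_congr rfl fun i hi => h i (Finset.mem_range.1 hi)
    rw [chooseIdx_succ, chooseIdx_succ, h1, ih fun i hi => h i (by omega)]

lemma sum_range_sq_sub_eq_dist_sq {d : ℕ} (x y : EuclideanSpace ℝ (Fin d)) {f g : ℕ → ℝ}
    (hf : ∀ j (hj : j < d), f j = x ⟨j, hj⟩) (hg : ∀ j (hj : j < d), g j = y ⟨j, hj⟩) :
    ∑ j ∈ Finset.range d, (f j - g j) ^ 2 = dist y x ^ 2 := by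
  rw [dist_comm, EuclideanSpace.dist_eq, Real.sq_sqrt (by positivity), Finset.sum_range]
  refine Finset.sum_congr rfl fun j _ => ?_
  rw [hf j j.2, hg j j.2, Real.dist_eq, sq_abs]

/-- The memory content that does not change during the trials. -/
structure Env {d : ℕ} (k N : ℕ) (X : ℕ → EuclideanSpace ℝ (Fin d)) (s : State) : Prop where
  n0 : s.natReg 0 = d
  n2 : s.natReg 2 = k
  n3 : s.natReg 3 = 1
  n4 : s.natReg 4 = 0
  n6 : s.natReg 6 = N * d
  n7 : s.natReg 7 = N
  r11 : s.realReg 11 = 1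
  r14 : s.realReg 14 = 0
  pts : ∀ p < N, ∀ j (hj : j < d), s.realArr 5 (p * d + j) = X p ⟨j, hj⟩

/-- Whether a program keeps what `Env` speaks about. -/
def Program.keepsEnv (p : Program) : Bool :=
  [0, 2, 3, 4, 6, 7].all (fun i => !p.any (Instr.writesNat i)) &&
    [11, 14].all (fun i => !p.any (Instr.writesReal i)) && !p.any (Instr.writesArr 5)

lemma Env.frame {d k N : ℕ} {X : ℕ → EuclideanSpace ℝ (Fin d)} {s s' : State} {p : Program}
    (h : Env k N X s) (hF : Frame p s s') (hp : p.keepsEnv = true) : Env k N X s' := by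
  simp [Program.keepsEnv] at hp
  obtain ⟨⟨⟨p0, p2, p3, p4, p6, p7⟩, q11, q14⟩, a5⟩ := hp
  exact ⟨(hF.nat _ p0).trans h.n0, (hF.nat _ p2).trans h.n2, (hF.nat _ p3).trans h.n3,
    (hF.nat _ p4).trans h.n4, (hF.nat _ p6).trans h.n6, (hF.nat _ p7).trans h.n7,
    (hF.real _ q11).trans h.r11, (hF.real _ q14).trans h.r14, by rw [hF.arr _ a5]; exact h.pts⟩

/-- The centres `cs` are stored from the beginning of the real array `a`. -/
def Stored {d : ℕ} (a : ℕ) (cs : List (EuclideanSpace ℝ (Fin d))) (s : State) : Prop :=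
  ∀ i (hi : i < cs.length) j (hj : j < d), s.realArr a (i * d + j) = cs[i] ⟨j, hj⟩

/-- The memory content during a trial. -/
structure RoundInv {d : ℕ} (N : ℕ) (X : ℕ → EuclideanSpace ℝ (Fin d))
    (cs : List (EuclideanSpace ℝ (Fin d))) (s : State) : Prop where
  n12 : s.natReg 12 = cs.length
  n13 : s.natReg 13 = cs.length * d
  r6 : s.realReg 6 = fallbackValue cs
  r3 : s.realReg 3 = ∑ i ∈ Finset.range N, weight X cs i
  wts : ∀ i < N, s.realArr 4 i = weight X cs i
  stored : Stored 3 cs s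

variable {ω : Tape} {s : State} {d k N : ℕ} {X : ℕ → EuclideanSpace ℝ (Fin d)}

lemma add_lt_mul_iff {i j d N : ℕ} (hj : j < d) : i * d + j < N * d ↔ i < N := by
  constructor
  · intro h
    by_contra hi
    have := Nat.mul_le_mul_right d (not_lt.1 hi)
    omega
  · intro h
    have := Nat.mul_le_mul_right d (Nat.succ_le_of_lt h)
    rw [Nat.succ_mul] at this
    omega

lemma roundProg_spec (hd : 1 ≤ d) (hN : 1 ≤ N) (hE : Env k N X s)
    {cs : List (EuclideanSpace ℝ (Fin d))} (hI : RoundInv N X cs s) :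
    Ex ω roundProg (100 * (N * d)) s fun s' =>
      RoundInv N X (cs ++ [nextCentre X N fallback cs (ω s.used)]) s' ∧
      s'.used = s.used + 1 := by
  set c := nextCentre X N fallback cs (ω s.used) with hc
  have hNd : d ≤ N * d := Nat.le_mul_of_pos_left d (by omega)
  refine (Ex.seq (T₁ := 3) (T₂ := 46 * (N * d) + 11 * d + 35) (Ex.block (Q := fun s' =>
    s'.realReg 4 = ω s.used * ∑ i ∈ Finset.range N, weight X cs i ∧ s'.used = s.used + 1)
    (by simp [Instr.exec, State.setReal, hI.r3])) ?_).mono (by omega) fun _ _ h => h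
  rintro s₁ hF₁ ⟨i4, iu⟩
  have hE₁ := hE.frame hF₁ rfl
  refine (Ex.seq (T₂ := 37 * (N * d) + 11 * d + 27) (scanPass_spec hd hE₁.n0 hE₁.n3 hE₁.n7)
    ?_).mono (by omega) fun _ _ h => h
  rintro s₂ hF₂ j14
  have hE₂ := hE₁.frame hF₂ rfl
  set idx := chooseIdx (weight X cs) N (ω s.used * ∑ i ∈ Finset.range N, weight X cs i) with hidx
  have j14' : s₂.natReg 14 = idx * d := by
    rw [j14, i4, hF₁.arr 4 rfl, chooseIdx_congr hI.wts]
  have f13 : s₂.natReg 13 = cs.length * d := by rw [hF₂.nat 13 rfl, hF₁.nat 13 rfl, hI.n13]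
  refine (Ex.seq (T₂ := 37 * (N * d) + 21)
    (copyPass_spec (C := cs.length * d) hE₂.n0 hE₂.n3 hE₂.n4 hE₂.n6 f13 hE₂.r14)
    ?_).mono (by omega) fun _ _ h => h
  rintro s₃ hF₃ ⟨k3, k3'⟩
  have hE₃ := hE₂.frame hF₃ rfl
  have g6 : s₂.realReg 6 = fallbackValue cs := by rw [hF₂.real 6 rfl, hF₁.real 6 rfl, hI.r6]
  have newc : ∀ j (hj : j < d), s₃.realArr 3 (cs.length * d + j) = c ⟨j, hj⟩ := by
    intro j hj
    rw [k3 j hj, j14', hc, nextCentre, g6]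
    by_cases h : idx < N
    · rw [if_pos ((add_lt_mul_iff hj).2 h), if_pos h, hE₂.pts idx h j hj]
    · rw [if_neg (fun h' => h ((add_lt_mul_iff hj).1 h')), if_neg h]
      rfl
  have st₃ : Stored 3 (cs ++ [c]) s₃ := by
    intro i hi j hj
    by_cases h : i < cs.length
    · rw [List.getElem_append_left h, k3' _ ((add_lt_mul_iff hj).2 h), hF₂.arr 3 rfl,
        hF₁.arr 3 rfl, hI.stored i h j hj]
    · obtain rfl : i = cs.length := by simp at hi; omega
      rw [newc j hj]
      simp
  have g13 : s₃.natReg 13 = cs.length * d := by rw [hF₃.nat 13 rfl, f13]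
  have hc0 : s₃.realArr 3 (cs.length * d) = coords c 0 := by
    have := newc 0 (by omega)
    rw [Nat.add_zero] at this
    rw [this, coords, dif_pos]
  have h6 : s₃.realReg 6 = fallbackValue cs := by rw [hF₃.real 6 rfl, g6]
  refine (Ex.seq (T₁ := 7) (T₂ := 37 * (N * d) + 13) (Ex.block (Q := fun s' =>
    s'.realReg 6 = fallbackValue (cs ++ [c]))
    (by simp [Instr.exec, State.setReal, h6, g13, hc0, hE₃.r11, fallbackValue]; ring)) ?_).mono
    (by omega) fun _ _ h => h
  rintro s₄ hF₄ l6
  have hE₄ := hE₃.frame hF₄ rfl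
  have l12 : s₄.natReg 12 = cs.length := by
    rw [hF₄.nat 12 rfl, hF₃.nat 12 rfl, hF₂.nat 12 rfl, hF₁.nat 12 rfl, hI.n12]
  have l13 : s₄.natReg 13 = cs.length * d := by rw [hF₄.nat 13 rfl, g13]
  have hnew : ∀ i < N, newWeight s₄ d cs.length (cs.length * d) (i * d) i =
      weight X (cs ++ [c]) i := by
    intro i hi
    have h4 : s₄.realArr 4 i = weight X cs i := by
      rw [hF₄.arr 4 rfl, hF₃.arr 4 rfl, hF₂.arr 4 rfl, hF₁.arr 4 rfl, hI.wts i hi]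
    rw [newWeight, h4, hF₄.arr 3 rfl,
      sum_range_sq_sub_eq_dist_sq (X i) c (fun j hj => hE₄.pts i hi j hj) newc]
    -- In the first round the unit weights are overwritten by the distances; later rounds take the
    -- minimum.
    by_cases h : cs = []
    · subst h
      rw [List.nil_append, weight_singleton]
      simp
    · rw [if_pos (List.length_pos_iff.2 h), weight_append X h]
  refine (Ex.seq (T₁ := 37 * (N * d) + 7) (T₂ := 3) (updatePass_spec hd hE₄.n0 hE₄.n3 hE₄.n4
    hE₄.n7 l12 l13 hE₄.r14) ?_).mono (by omega) fun _ _ h => h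
  rintro s₅ hF₅ ⟨m3, m4⟩
  have hE₅ := hE₄.frame hF₅ rfl
  have b12 : s₅.natReg 12 = cs.length := by rw [hF₅.nat 12 rfl, l12]
  have b13 : s₅.natReg 13 = cs.length * d := by rw [hF₅.nat 13 rfl, l13]
  have b3 : s₅.realArr 3 = s₃.realArr 3 := by rw [hF₅.arr 3 rfl, hF₄.arr 3 rfl]
  have b6 : s₅.realReg 6 = fallbackValue (cs ++ [c]) := by rw [hF₅.real 6 rfl, l6]
  have bu : s₅.used = s.used + 1 := by
    rw [hF₅.used rfl, hF₄.used rfl, hF₃.used rfl, hF₂.used rfl, iu]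
  refine Ex.block ⟨⟨?_, ?_, ?_, ?_, ?_, ?_⟩, ?_⟩
  · simp [Instr.exec, State.setNat, hE₅.n3, b12]
  · simp [Instr.exec, State.setNat, hE₅.n0, b13, Nat.succ_mul]
  · simpa [Instr.exec, State.setNat] using b6
  · have : s₅.realReg 3 = ∑ i ∈ Finset.range N, weight X (cs ++ [c]) i :=
      m3.trans (Finset.sum_congr rfl fun i hi => hnew i (Finset.mem_range.1 hi))
    simpa [Instr.exec, State.setNat] using this
  · intro i hi
    simpa [Instr.exec, State.setNat, hnew i hi] using m4 i hi
  · intro i hi j hj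
    have := st₃ i hi j hj
    rw [← b3] at this
    simpa [Instr.exec, State.setNat] using this
  · simpa [Instr.exec, State.setNat] using bu

lemma trialProg_spec (hd : 1 ≤ d) (hk : 1 ≤ k) (hN : 1 ≤ N) (hE : Env k N X s) :
    Ex ω trialProg (120 * (k * (N * d))) s fun s' =>
      Stored 3 (seeding X N fallback [] k (ω.drop s.used)) s' ∧
      s'.realReg 3 = cost X N (seeding X N fallback [] k (ω.drop s.used)) ∧
      s'.natReg 13 = k * d ∧ s'.used = s.used + k := by
  have hNd : N ≤ N * d := Nat.le_mul_of_pos_right N (by omega)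
  have hkNd : N * d ≤ k * (N * d) := Nat.le_mul_of_pos_left _ (by omega)
  have hkk : k ≤ k * (N * d) := Nat.le_mul_of_pos_right _ (by positivity)
  have hlen : ∀ m, (seeding X N fallback [] m (ω.drop s.used)).length = m := fun m => by
    rw [length_seeding]; simp
  refine (Ex.seq (T₁ := 1) (T₂ := k * (100 * (N * d) + 1) + 4 * N + 11)
    (Q' := fun s' => s'.natReg 8 = 0)
    ⟨1, le_rfl, _, .instr _ _, by simp [Instr.exec, State.setNat]⟩ ?_).mono ?_ fun _ _ h => h
  rotate_left
  · rw [Nat.mul_add, Nat.mul_left_comm]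
    omega
  rintro s₁ hF₁ i8
  have hE₁ := hE.frame hF₁ rfl
  refine (Ex.seq (T₁ := N * 4 + 1) (T₂ := k * (100 * (N * d) + 1) + 9)
    (Q' := fun s' => ∀ i < N, s'.realArr 4 i = 1) ?_ ?_).mono (by omega) fun _ _ h => h
  · refine (Ex.loop (T := 3) (fun m s' => s'.natReg 8 = m ∧ ∀ i < m, s'.realArr 4 i = 1) N
      ⟨i8, by simp⟩ ?_ ?_).mono le_rfl fun _ _ h => h.2
    · rintro m hm s₂ hF₂ ⟨j8, j4⟩
      have hE₂ := hE₁.frame hF₂ rfl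
      refine ⟨by simp [Test.Holds, hE₂.n7, j8, hm], Ex.block ⟨?_, ?_⟩⟩
      · simp [Instr.exec, State.setNat, j8, hE₂.n3]
      · intro i hi
        rcases Nat.lt_succ_iff_lt_or_eq.1 hi with h | rfl
        · simp [Instr.exec, State.setNat, j8, h.ne, j4 i h]
        · simp [Instr.exec, State.setNat, j8, hE₂.r11]
    · rintro s₂ hF₂ ⟨j8, -⟩
      have hE₂ := hE₁.frame hF₂ rfl
      simp [Test.Holds, hE₂.n7, j8]
  rintro s₂ hF₂ j4
  have hE₂ := hE₁.frame hF₂ rfl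
  refine (Ex.seq (T₁ := 7) (T₂ := k * (100 * (N * d) + 1) + 1) (Ex.block (Q := fun s' =>
    s'.realReg 3 = N ∧ s'.realReg 6 = 1 ∧ s'.natReg 12 = 0 ∧ s'.natReg 13 = 0)
    (by simp [Instr.exec, State.setNat, State.setReal, hE₂.n7])) ?_).mono (by omega) fun _ _ h => h
  rintro s₃ hF₃ ⟨k3, k6, k12, k13⟩
  have hE₃ := hE₂.frame hF₃ rfl
  have ku : s₃.used = s.used := by rw [hF₃.used rfl, hF₂.used rfl, hF₁.used rfl]
  refine (Ex.loop (T := 100 * (N * d)) (fun m s' =>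
    RoundInv N X (seeding X N fallback [] m (ω.drop s.used)) s' ∧ s'.used = s.used + m) k
    ⟨⟨?_, ?_, ?_, ?_, ?_, ?_⟩, ku⟩ ?_ ?_).mono le_rfl ?_
  · exact k12
  · simpa [seeding] using k13
  · simpa [seeding, fallbackValue] using k6
  · simpa [seeding, weight] using k3
  · intro i hi
    simpa [seeding, weight, hF₃.arr 4 rfl] using j4 i hi
  · intro i hi
    simp [seeding] at hi
  · rintro m hm s₄ hF₄ ⟨hI, hu⟩
    have hE₄ := hE₃.frame hF₄ rfl
    refine ⟨by simp [Test.Holds, hI.n12, hE₄.n2, hlen, hm],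
      (roundProg_spec hd hN hE₄ hI).mono le_rfl ?_⟩
    rintro s₅ - ⟨hI', hu'⟩
    rw [hu] at hI' hu'
    rw [seeding_succ]
    exact ⟨hI', hu'⟩
  · rintro s₄ hF₄ ⟨hI, -⟩
    have hE₄ := hE₃.frame hF₄ rfl
    simp [Test.Holds, hI.n12, hE₄.n2, hlen]
  · rintro s₄ - ⟨hI, hu⟩
    refine ⟨hI.stored, ?_, ?_, hu⟩
    · rw [hI.r3, cost_eq]
      exact List.length_pos_iff.1 (by rw [hlen]; omega)
    · rw [hI.n13, hlen]

lemma saveProg_spec (hE : Env k N X s) (h13 : s.natReg 13 = k * d)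
    {cs : List (EuclideanSpace ℝ (Fin d))} (hcs : cs.length = k) (hst : Stored 3 cs s) :
    Ex ω saveProg (6 * (k * d) + 5) s fun s' => Stored 2 cs s' ∧ s'.realReg 10 = s.realReg 3 := by
  refine (Ex.seq (T₁ := 1) (T₂ := 6 * (k * d) + 3) (Q' := fun s' => s'.natReg 8 = 0)
    ⟨1, le_rfl, _, .instr _ _, by simp [Instr.exec, State.setNat]⟩ ?_).mono le_rfl fun _ _ h => h
  rintro s₁ hF₁ i8
  have hE₁ := hE.frame hF₁ rfl
  refine (Ex.seq (T₁ := k * d * 6 + 1) (T₂ := 1)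
    (Q' := fun s' => ∀ x < k * d, s'.realArr 2 x = s.realArr 3 x) ?_ ?_).mono (by omega)
    fun _ _ h => h
  · refine (Ex.loop (T := 5) (fun m s' => s'.natReg 8 = m ∧
      ∀ x < m, s'.realArr 2 x = s.realArr 3 x) (k * d) ⟨i8, by simp⟩ ?_ ?_).mono le_rfl
      fun _ _ h => h.2
    · rintro m hm s₂ hF₂ ⟨j8, j2⟩
      have hE₂ := hE₁.frame hF₂ rfl
      have j13 : s₂.natReg 13 = k * d := by rw [hF₂.nat 13 rfl, hF₁.nat 13 rfl, h13]
      have j3 : s₂.realArr 3 = s.realArr 3 := by rw [hF₂.arr 3 rfl, hF₁.arr 3 rfl]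
      refine ⟨by simp [Test.Holds, j13, j8, hm], Ex.block ⟨?_, ?_⟩⟩
      · simp [Instr.exec, State.setNat, State.setReal, j8, hE₂.n3]
      · intro i hi
        rcases Nat.lt_succ_iff_lt_or_eq.1 hi with h | rfl
        · simp [Instr.exec, State.setNat, State.setReal, j8, h.ne, j2 i h]
        · simp [Instr.exec, State.setNat, State.setReal, j8, j3]
    · rintro s₂ hF₂ ⟨j8, -⟩
      have j13 : s₂.natReg 13 = k * d := by rw [hF₂.nat 13 rfl, hF₁.nat 13 rfl, h13]
      simp [Test.Holds, j13, j8]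
  · rintro s₂ hF₂ j2
    have hE₂ := hE₁.frame hF₂ rfl
    have j3 : s₂.realReg 3 = s.realReg 3 := by rw [hF₂.real 3 rfl, hF₁.real 3 rfl]
    refine ⟨1, le_rfl, _, .instr _ _, ?_, ?_⟩
    · intro i hi j hj
      simp only [Instr.exec, State.setReal]
      rw [j2 _ ((add_lt_mul_iff hj).2 (hcs ▸ hi)), hst i hi j hj]
    · simp [Instr.exec, State.setReal, hE₂.r14, j3]

end Verification

end SegClust

end

noncomputable section

namespace SegClust

/-! ### Repeated trials and the best outcome -/

section MainLoop

variable {ω : Tape} {s : State} {d k N : ℕ} {X : ℕ → EuclideanSpace ℝ (Fin d)}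

/-- The centres that trial number `r` produces. -/
def trialCentres (k N : ℕ) (X : ℕ → EuclideanSpace ℝ (Fin d)) (ω : Tape) (r : ℕ) :
    List (EuclideanSpace ℝ (Fin d)) :=
  seeding X N fallback [] k (ω.drop (r * k))

lemma length_trialCentres (r : ℕ) : (trialCentres k N X ω r).length = k := by
  rw [trialCentres, length_seeding]
  simp

/-- After `m` trials the best one is stored. -/
def BestStored (k N : ℕ) (X : ℕ → EuclideanSpace ℝ (Fin d)) (ω : Tape) (m : ℕ) (s : State) : Prop :=
  ∃ r < m, Stored 2 (trialCentres k N X ω r) s ∧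
    s.realReg 10 = cost X N (trialCentres k N X ω r) ∧
    ∀ r' < m, cost X N (trialCentres k N X ω r) ≤ cost X N (trialCentres k N X ω r')

/-- The machine has no logarithm, so the loop halves a real register until it is at most δ; `hRδ`
and `hδ` say that this happens for the first time after R trials. Trial r reads the tape from
position r k. -/
lemma mainLoop_spec (hd : 1 ≤ d) (hk : 1 ≤ k) (hN : 1 ≤ N) (hE : Env k N X s) {δ : ℝ}
    (h1 : s.realReg 1 = δ) (h2 : s.realReg 2 = 1) (h13 : s.realReg 13 = 2) (hu : s.used = 0)
    {R : ℕ} (hR : 1 ≤ R) (hRδ : (1 / 2 : ℝ) ^ R ≤ δ) (hδ : ∀ m < R, δ < (1 / 2 : ℝ) ^ m) :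
    Ex ω mainLoop (150 * (R * (k * (N * d)))) s fun s' => BestStored k N X ω R s' := by
  have hkd : k * d ≤ k * (N * d) := Nat.mul_le_mul_left k (Nat.le_mul_of_pos_left d (by omega))
  have hpos : 1 ≤ k * (N * d) := by
    have : 0 < k * (N * d) := by positivity
    omega
  have hRk : R ≤ R * (k * (N * d)) := Nat.le_mul_of_pos_right _ hpos
  refine (Ex.loop (T := 120 * (k * (N * d)) + 6 * (k * d) + 15) (fun m s' =>
    s'.realReg 2 = (1 / 2 : ℝ) ^ m ∧ s'.used = m * k ∧
      (0 < m → BestStored k N X ω m s')) R ⟨by simpa using h2, by simpa using hu, by simp⟩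
      ?_ ?_).mono ?_ fun _ _ h => h.2.2 (by omega)
  · rintro m hm s₁ hF₁ ⟨i2, iu, iB⟩
    have hE₁ := hE.frame hF₁ rfl
    have i1 : s₁.realReg 1 = δ := (hF₁.real 1 rfl).trans h1
    refine ⟨by simpa [Test.Holds, i1, i2] using hδ m hm, ?_⟩
    refine (Ex.seq (T₂ := 6 * (k * d) + 9) (trialProg_spec hd hk hN hE₁) ?_).mono
      (by omega) fun _ _ h => h
    rintro s₂ hF₂ ⟨j3, jc, j13, ju⟩
    rw [iu] at j3 jc ju
    have hE₂ := hE₁.frame hF₂ rfl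
    have j2 : s₂.realReg 2 = (1 / 2 : ℝ) ^ m := (hF₂.real 2 rfl).trans i2
    have jt : s₂.realReg 13 = 2 := ((hF₂.real 13 rfl).trans (hF₁.real 13 rfl)).trans h13
    have save : (∀ r' < m, cost X N (trialCentres k N X ω m) ≤
        cost X N (trialCentres k N X ω r')) →
        Ex ω saveProg (6 * (k * d) + 5) s₂ (BestStored k N X ω (m + 1)) := by
      intro hbest
      refine (saveProg_spec hE₂ j13 (length_trialCentres m) j3).mono le_rfl ?_
      rintro s₃ - ⟨k2, k10⟩
      refine ⟨m, by omega, k2, k10.trans jc, fun r' hr' => ?_⟩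
      rcases Nat.lt_succ_iff_lt_or_eq.1 hr' with h | rfl
      · exact hbest r' h
      · exact le_rfl
    refine (Ex.seq (T₁ := 6 * (k * d) + 7) (T₂ := 1) (Q' := BestStored k N X ω (m + 1))
      (Ex.ite (fun hb => ?_) fun hb => ?_) ?_).mono (by omega) fun _ _ h => h
    · have hm0 : 0 < m := by
        rcases Nat.eq_zero_or_pos m with h | h
        · simp [Test.Holds, j2, hE₂.r11, h] at hb
        · exact h
      obtain ⟨r, hr, b2, b10, bb⟩ := iB hm0
      have b10' : s₂.realReg 10 = cost X N (trialCentres k N X ω r) := (hF₂.real 10 rfl).trans b10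
      refine (Ex.ite (T := 6 * (k * d) + 5) (fun hb' => ?_) fun hb' => ?_).mono le_rfl
        fun _ _ h => h
      · simp only [Test.Holds, b10', jc] at hb'
        exact save fun r' hr' => hb'.le.trans (bb r' hr')
      · simp only [Test.Holds, b10', jc, not_lt] at hb'
        refine ⟨1, by omega, _, .instr _ _, r, by omega, ?_, ?_, fun r' hr' => ?_⟩
        · intro i hi j hj
          simp only [Instr.exec, State.setNat]
          rw [hF₂.arr 2 rfl]
          exact b2 i hi j hj
        · simpa [Instr.exec, State.setNat] using b10'
        · rcases Nat.lt_succ_iff_lt_or_eq.1 hr' with h | rfl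
          · exact bb r' h
          · exact hb'
    · refine (save fun r' hr' => ?_).mono (by omega) fun _ _ h => h
      have : (1 / 2 : ℝ) ^ m < 1 := pow_lt_one₀ (by norm_num) (by norm_num) (by omega)
      exact absurd (by simpa only [Test.Holds, j2, hE₂.r11] using this) hb
    · rintro s₃ hF₃ ⟨r, hr, b2, b10, bb⟩
      have k2 : s₃.realReg 2 = (1 / 2 : ℝ) ^ m := (hF₃.real 2 rfl).trans j2
      have kt : s₃.realReg 13 = 2 := (hF₃.real 13 rfl).trans jt
      have ku : s₃.used = m * k + k := (hF₃.used rfl).trans ju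
      refine ⟨1, le_rfl, _, .instr _ _, ?_, ?_, fun _ => ⟨r, hr, ?_, ?_, bb⟩⟩
      · simp [Instr.exec, State.setReal, k2, kt, pow_succ]
        ring
      · simpa [Instr.exec, State.setReal, Nat.succ_mul] using ku
      · intro i hi j hj
        simpa [Instr.exec, State.setReal] using b2 i hi j hj
      · simpa [Instr.exec, State.setReal] using b10
  · rintro s₁ hF₁ ⟨i2, -⟩
    have i1 : s₁.realReg 1 = δ := (hF₁.real 1 rfl).trans h1
    simpa [Test.Holds, i1, i2] using hRδ
  · have h3 : R * (120 * (k * (N * d)) + 6 * (k * d) + 15 + 1) ≤ R * (142 * (k * (N * d))) :=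
      Nat.mul_le_mul_left R (by omega)
    have h4 : R * (142 * (k * (N * d))) = 142 * (R * (k * (N * d))) := by ring
    omega

end MainLoop

/-! ### Construction of the grid and the whole program -/

section Grid

variable {ω : Tape} {s : State} {d : ℕ}

lemma gridPointLoop_spec {a P : ℕ} {x : ℝ} (h0 : s.natReg 0 = d) (h3 : s.natReg 3 = 1)
    (h10 : s.natReg 10 = 0) (h14 : s.natReg 14 = a) (h11 : s.natReg 11 = P)
    (h7 : s.realReg 7 = x) :
    Ex ω gridPointLoop (16 * d + 1) s fun s' => s'.natReg 11 = P + d ∧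
      (∀ j < d, s'.realArr 5 (P + j) = s.realArr 0 (a + j) + x * s.realArr 1 (a + j)) ∧
      ∀ y < P, s'.realArr 5 y = s.realArr 5 y := by
  refine (Ex.loop (T := 15) (fun m s' => s'.natReg 10 = m ∧ s'.natReg 14 = a + m ∧
    s'.natReg 11 = P + m ∧
    (∀ j < m, s'.realArr 5 (P + j) = s.realArr 0 (a + j) + x * s.realArr 1 (a + j)) ∧
      ∀ y < P, s'.realArr 5 y = s.realArr 5 y) d (by simp [*]) ?_ ?_).mono (by omega)
    fun _ _ h => h.2.2
  · rintro m hm s₁ hF ⟨i10, i14, i11, i5, i5'⟩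
    have e0 := hF.nat 0 rfl
    have e3 := (hF.nat 3 rfl).trans h3
    have e7 := (hF.real 7 rfl).trans h7
    have a0 := hF.arr 0 rfl
    have a1 := hF.arr 1 rfl
    refine ⟨by simp [Test.Holds, *], Ex.block ?_⟩
    simp only [List.foldl_cons, List.foldl_nil, Instr.exec, State.setNat, State.setReal]
    refine ⟨by simp [*], by simp [*, Nat.add_assoc], by simp [*, Nat.add_assoc], ?_, ?_⟩
    · intro j hj
      rcases Nat.lt_succ_iff_lt_or_eq.1 hj with h | rfl
      · simp [i11, h.ne, i5 j h]
      · simp [i11, i14, e7, a0, a1]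
    · intro y hy
      have : y ≠ P + m := by omega
      simp [i11, this, i5' y hy]
  · rintro s₁ hF ⟨i10, -⟩
    simp [Test.Holds, hF.nat 0 rfl, *]

/-- The grid points of the segments, segment after segment. -/
def gridPoint {n : ℕ} (M : ℕ) (L : Fin n → Segment d) (p : ℕ) : EuclideanSpace ℝ (Fin d) :=
  if h : p / M < n then (L ⟨p / M, h⟩).point ((p % M : ℕ) / (M : ℝ)) else 0

lemma gridPoint_add {n M : ℕ} (L : Fin n → Segment d) (i : Fin n) {t : ℕ} (ht : t < M) :
    gridPoint M L (i * M + t) = (L i).point (t / M) := by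
  have hM : 0 < M := by omega
  have h1 : (i * M + t) / M = i := by
    rw [Nat.add_comm, Nat.add_mul_div_right _ _ hM, Nat.div_eq_of_lt ht, Nat.zero_add]
  have h2 : (i * M + t) % M = t := by
    rw [Nat.add_comm, Nat.add_mul_mod_self_right, Nat.mod_eq_of_lt ht]
  unfold gridPoint
  rw [dif_pos (by rw [h1]; exact i.2), h2]
  congr 2
  exact Fin.ext h1

lemma flatten_apply {n : ℕ} (x : Fin n → EuclideanSpace ℝ (Fin d)) (i : Fin n) {j : ℕ}
    (hj : j < d) : flatten x (i * d + j) = x i ⟨j, hj⟩ := by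
  have hd : 0 < d := by omega
  have h1 : (i * d + j) / d = i := by
    rw [Nat.add_comm, Nat.add_mul_div_right _ _ hd, Nat.div_eq_of_lt hj, Nat.zero_add]
  have h2 : (i * d + j) % d = j := by
    rw [Nat.add_comm, Nat.add_mul_mod_self_right, Nat.mod_eq_of_lt hj]
  unfold flatten
  have h3 : (⟨(i * d + j) / d, by rw [h1]; exact i.2⟩ : Fin n) = i := Fin.ext h1
  rw [dif_pos (by rw [h1]; exact i.2), h2, coords, dif_pos hj, h3]

/-- The first `q` grid points are stored in the real array `5`. -/
def GridStored {n : ℕ} (M : ℕ) (L : Fin n → Segment d) (q : ℕ) (s : State) : Prop :=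
  s.natReg 7 = q ∧ s.natReg 11 = q * d ∧
    ∀ p < q, ∀ j (hj : j < d), s.realArr 5 (p * d + j) = gridPoint M L p ⟨j, hj⟩

/-- The memory content that does not change during the construction of the grid. -/
structure GridEnv {n : ℕ} (M : ℕ) (L : Fin n → Segment d) (s : State) : Prop where
  n0 : s.natReg 0 = d
  n1 : s.natReg 1 = n
  n3 : s.natReg 3 = 1
  n4 : s.natReg 4 = 0
  n5 : s.natReg 5 = M
  r12 : s.realReg 12 = M
  a0 : s.realArr 0 = flatten fun i => (L i).u
  a1 : s.realArr 1 = flatten fun i => (L i).v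

/-- Whether a program keeps what `GridEnv` speaks about. -/
def Program.keepsGridEnv (p : Program) : Bool :=
  [0, 1, 3, 4, 5].all (fun i => !p.any (Instr.writesNat i)) &&
    !p.any (Instr.writesReal 12) && [0, 1].all (fun i => !p.any (Instr.writesArr i))

variable {n M : ℕ} {L : Fin n → Segment d}

lemma GridEnv.frame {s' : State} {p : Program} (h : GridEnv M L s) (hF : Frame p s s')
    (hp : p.keepsGridEnv = true) : GridEnv M L s' := by
  simp [Program.keepsGridEnv] at hp
  obtain ⟨⟨⟨p0, p1, p3, p4, p5⟩, q12⟩, b0, b1⟩ := hp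
  exact ⟨(hF.nat _ p0).trans h.n0, (hF.nat _ p1).trans h.n1, (hF.nat _ p3).trans h.n3,
    (hF.nat _ p4).trans h.n4, (hF.nat _ p5).trans h.n5, (hF.real _ q12).trans h.r12,
    (hF.arr _ b0).trans h.a0, (hF.arr _ b1).trans h.a1⟩

lemma gridSegmentLoop_spec (i : Fin n) (hE : GridEnv M L s) (h9 : s.natReg 9 = 0)
    (h13 : s.natReg 13 = i * d) (hG : GridStored M L (i * M) s) :
    Ex ω gridSegmentLoop (M * (16 * d + 14) + 1) s (GridStored M L ((i + 1) * M)) := by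
  refine (Ex.loop (T := 16 * d + 13) (fun m s' => s'.natReg 9 = m ∧
    GridStored M L (i * M + m) s') M ⟨h9, hG⟩ ?_ ?_).mono le_rfl
    fun _ _ h => by rw [Nat.succ_mul]; exact h.2
  · rintro m hm s₁ hF₁ ⟨i9, i7, i11, iG⟩
    have hE₁ := hE.frame hF₁ rfl
    have i13 := (hF₁.nat 13 rfl).trans h13
    refine ⟨by simp [Test.Holds, i9, hE₁.n5, hm], ?_⟩
    refine (Ex.seq (T₁ := 7) (T₂ := 16 * d + 5) (Ex.block (Q := fun s' => s'.natReg 10 = 0 ∧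
      s'.natReg 14 = i * d ∧ s'.realReg 7 = m / M)
      (by simp [Instr.exec, State.setNat, State.setReal, hE₁.n4, hE₁.r12, i13, i9])) ?_).mono
      (by omega) fun _ _ h => h
    rintro s₂ hF₂ ⟨j10, j14, j7⟩
    have hE₂ := hE₁.frame hF₂ rfl
    refine (Ex.seq (T₂ := 3) (gridPointLoop_spec hE₂.n0 hE₂.n3 j10 j14
      ((hF₂.nat 11 rfl).trans i11) j7) ?_).mono (by omega) fun _ _ h => h
    rintro s₃ hF₃ ⟨k11, k5, k5'⟩
    have hE₃ := hE₂.frame hF₃ rfl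
    have k9 : s₃.natReg 9 = m := ((hF₃.nat 9 rfl).trans (hF₂.nat 9 rfl)).trans i9
    have k7 : s₃.natReg 7 = i * M + m := ((hF₃.nat 7 rfl).trans (hF₂.nat 7 rfl)).trans i7
    refine Ex.block ⟨?_, ?_, ?_, ?_⟩
    · simp [Instr.exec, State.setNat, k9, hE₃.n3]
    · simp [Instr.exec, State.setNat, k7, hE₃.n3, Nat.add_assoc]
    · rw [← Nat.add_assoc, Nat.succ_mul]
      simpa [Instr.exec, State.setNat] using k11
    · intro p hp j hj
      simp only [List.foldl_cons, List.foldl_nil, Instr.exec, State.setNat]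
      by_cases h : p < i * M + m
      · rw [k5' _ ((add_lt_mul_iff hj).2 h), hF₂.arr 5 rfl, iG p h j hj]
      · obtain rfl : p = i * M + m := by omega
        rw [k5 j hj, hE₂.a0, hE₂.a1, flatten_apply _ i hj, flatten_apply _ i hj,
          gridPoint_add L i hm]
        rfl
  · rintro s₁ hF₁ ⟨i9, -⟩
    have hE₁ := hE.frame hF₁ rfl
    simp [Test.Holds, i9, hE₁.n5]

lemma gridProg_spec (hE : GridEnv M L s) (h8 : s.natReg 8 = 0) (h13 : s.natReg 13 = 0)
    (h7 : s.natReg 7 = 0) (h11 : s.natReg 11 = 0) :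
    Ex ω gridProg (n * (M * (16 * d + 14) + 8) + 1) s (GridStored M L (n * M)) := by
  refine (Ex.loop (T := M * (16 * d + 14) + 7) (fun m s' => s'.natReg 8 = m ∧
    s'.natReg 13 = m * d ∧ GridStored M L (m * M) s') n
    ⟨h8, by simpa using h13, by simpa using h7, by simpa using h11, by simp⟩ ?_ ?_).mono le_rfl
    fun _ _ h => h.2.2
  · rintro m hm s₁ hF₁ ⟨i8, i13, i7, i11, iG⟩
    have hE₁ := hE.frame hF₁ rfl
    refine ⟨by simp [Test.Holds, i8, hE₁.n1, hm], ?_⟩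
    refine (Ex.seq (T₁ := 1) (T₂ := M * (16 * d + 14) + 5) (Q' := fun s' => s'.natReg 9 = 0)
      ⟨1, le_rfl, _, .instr _ _, by simp [Instr.exec, State.setNat]⟩ ?_).mono (by omega)
      fun _ _ h => h
    rintro s₂ hF₂ j9
    have hE₂ := hE₁.frame hF₂ rfl
    have j13 := (hF₂.nat 13 rfl).trans i13
    have jG : GridStored M L (m * M) s₂ :=
      ⟨(hF₂.nat 7 rfl).trans i7, (hF₂.nat 11 rfl).trans i11, by rw [hF₂.arr 5 rfl]; exact iG⟩
    refine (Ex.seq (T₂ := 3) (gridSegmentLoop_spec ⟨m, hm⟩ hE₂ j9 j13 jG) ?_).mono (by omega)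
      fun _ _ h => h
    rintro s₃ hF₃ ⟨k7, k11, kG⟩
    have hE₃ := hE₂.frame hF₃ rfl
    have k8 := ((hF₃.nat 8 rfl).trans (hF₂.nat 8 rfl)).trans i8
    have k13 := (hF₃.nat 13 rfl).trans j13
    refine Ex.block ⟨?_, ?_, ?_, ?_, ?_⟩
    · simp [Instr.exec, State.setNat, k8, hE₃.n3]
    · simp [Instr.exec, State.setNat, k13, hE₃.n0, Nat.succ_mul]
    · simpa [Instr.exec, State.setNat] using k7
    · simpa [Instr.exec, State.setNat] using k11
    · simpa [Instr.exec, State.setNat] using kG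
  · rintro s₁ hF₁ ⟨i8, -⟩
    have hE₁ := hE.frame hF₁ rfl
    simp [Test.Holds, i8, hE₁.n1]

/-- A trial has k rounds of order N d with N = 2kn, whence d n k² per trial; building the grid takes
only order d n k. -/
lemma clusterProg_spec (hd : 1 ≤ d) {k : ℕ} (hn : 1 ≤ n) (hk : 1 ≤ k) (ε : ℝ) {δ : ℝ} {R : ℕ}
    (hR : 1 ≤ R) (hRδ : (1 / 2 : ℝ) ^ R ≤ δ) (hδ : ∀ m < R, δ < (1 / 2 : ℝ) ^ m) :
    Ex ω clusterProg (1000 * (d * n * k ^ 2 * R)) (inputState k L ε δ) fun s' =>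
      BestStored k (n * (2 * k)) (gridPoint (2 * k) L) ω R s' := by
  set N := n * (2 * k) with hNdef
  have hN : 1 ≤ N := Nat.mul_pos hn (by omega)
  refine (Ex.seq (T₁ := 11) (T₂ := n * (2 * k * (16 * d + 14) + 8) + 1 +
    (150 * (R * (k * (N * d))) + 2) + 1) (Ex.block (Q := fun s' => GridEnv (2 * k) L s' ∧
      s'.natReg 2 = k ∧ s'.natReg 8 = 0 ∧ s'.natReg 13 = 0 ∧ s'.natReg 7 = 0 ∧
      s'.natReg 11 = 0 ∧ s'.realReg 11 = 1 ∧ s'.realReg 14 = 0 ∧ s'.realReg 1 = δ ∧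
      s'.realReg 2 = 1 ∧ s'.realReg 13 = 2 ∧ s'.used = 0)
    ⟨⟨?_, ?_, ?_, ?_, ?_, ?_, ?_, ?_⟩, ?_⟩) ?_).mono ?_ fun _ _ h => h
  iterate 9
    simp [Instr.exec, State.setNat, State.setReal, inputState, two_mul]
  · rintro s₁ hF₁ ⟨hE₁, i2, i8, i13, i7, i11, r11, r14, r1, r2, r13, iu⟩
    refine (Ex.seq (T₂ := 150 * (R * (k * (N * d))) + 2) (gridProg_spec hE₁ i8 i13 i7 i11) ?_).mono
      (by omega) fun _ _ h => h
    rintro s₂ hF₂ ⟨j7, j11, jG⟩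
    have hE₂ := hE₁.frame hF₂ rfl
    refine (Ex.seq (T₁ := 1) (T₂ := 150 * (R * (k * (N * d)))) (Q' := fun s' =>
      s'.natReg 6 = N * d)
      ⟨1, le_rfl, _, .instr _ _, by simp [Instr.exec, State.setNat, j11, hE₂.n4, hNdef]⟩ ?_).mono
      (by omega) fun _ _ h => h
    rintro s₃ hF₃ k6
    have hE₃ := hE₂.frame hF₃ rfl
    have hE : Env k N (gridPoint (2 * k) L) s₃ := by
      refine ⟨hE₃.n0, ?_, hE₃.n3, hE₃.n4, k6, ?_, ?_, ?_, ?_⟩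
      · rw [hF₃.nat 2 rfl, hF₂.nat 2 rfl, i2]
      · rw [hF₃.nat 7 rfl, j7]
      · rw [hF₃.real 11 rfl, hF₂.real 11 rfl, r11]
      · rw [hF₃.real 14 rfl, hF₂.real 14 rfl, r14]
      · rw [hF₃.arr 5 rfl]
        exact jG
    refine mainLoop_spec hd hk hN hE ?_ ?_ ?_ ?_ hR hRδ hδ
    · rw [hF₃.real 1 rfl, hF₂.real 1 rfl, r1]
    · rw [hF₃.real 2 rfl, hF₂.real 2 rfl, r2]
    · rw [hF₃.real 13 rfl, hF₂.real 13 rfl, r13]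
    · rw [hF₃.used rfl, hF₂.used rfl, iu]
  · set W := d * n * k ^ 2 * R with hW
    have e1 : 150 * (R * (k * (N * d))) = 300 * W := by rw [hW, hNdef]; ring
    have e2 : n * (2 * k * (16 * d + 14) + 8) = 32 * (n * k * d) + 28 * (n * k) + 8 * n := by ring
    have h1 : n * k * d ≤ W := by
      have : W = n * k * d * (k * R) := by rw [hW]; ring
      rw [this]
      exact Nat.le_mul_of_pos_right _ (by positivity)
    have h2 : n * k ≤ n * k * d := Nat.le_mul_of_pos_right _ hd
    have h3 : n ≤ n * k := Nat.le_mul_of_pos_right _ hk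
    omega

end Grid

end SegClust

end

noncomputable section

namespace SegClust

/-! ### The guarantee -/

section Guarantee

variable {d n k : ℕ}

lemma gridLoss_eq_sum (P : Finset (EuclideanSpace ℝ (Fin d)))
    (L : Fin n → Segment d) :
    gridLoss k P L =
      ∑ p ∈ Finset.range (n * (2 * k)), sqDist P (gridPoint (2 * k) L p) := by
  set f : ℕ → ℝ := fun p => sqDist P (gridPoint (2 * k) L p) with hf
  have key : ∀ m, ∑ p ∈ Finset.range (m * (2 * k)), f p =
      ∑ i ∈ Finset.range m, ∑ t ∈ Finset.range (2 * k), f (i * (2 * k) + t) := by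
    intro m
    induction m with
    | zero => simp
    | succ m ih => rw [Nat.succ_mul, Finset.sum_range_add, ih, Finset.sum_range_succ]
  rw [key, Finset.sum_range, gridLoss]
  refine Finset.sum_congr rfl fun i _ => Finset.sum_congr rfl fun t ht => ?_
  rw [hf]
  simp only
  rw [gridPoint_add L i (Finset.mem_range.1 ht)]

/-- H_{k-1} ≤ H_k ≤ 1 + ln k, and ln k ≤ log₂ k because ln 2 ≤ 1. -/
lemma one_add_harmonic_le (hk : 1 ≤ k) :
    1 + (harmonic (k - 1) : ℝ) ≤ 2 * (1 + Real.logb 2 k) := by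
  have hk1 : (1 : ℝ) ≤ k := by exact_mod_cast hk
  have h0 : 0 ≤ Real.log k := Real.log_nonneg hk1
  have h1 : Real.log k ≤ Real.logb 2 k := by
    rw [Real.logb, le_div_iff₀ (Real.log_pos (by norm_num))]
    have : Real.log 2 ≤ 1 := by linarith [Real.log_two_lt_d9]
    nlinarith
  have h2 : (harmonic (k - 1) : ℝ) ≤ harmonic k := by
    obtain ⟨m, rfl⟩ : ∃ m, k = m + 1 := ⟨k - 1, by omega⟩
    rw [harmonic_succ, Nat.add_sub_cancel]
    push_cast
    have : (0 : ℝ) ≤ ((m : ℝ) + 1)⁻¹ := by positivity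
    linarith
  have h3 := harmonic_le_one_add_log k
  linarith

open Classical in
-- 20736 = 18 · 8 · 4 · 18 · 2: two passages between loss and grid, twice the expected cost of the
-- seeding, spread against cost, and the harmonic number against log₂.
lemma loss_le_of_cost_le (hk : 1 ≤ k) (L : Fin n → Segment d)
    {cs : List (EuclideanSpace ℝ (Fin d))} (hcs : cs.toFinset.card = k)
    {a : Fin (n * (2 * k)) → Fin k}
    (ha : ∀ P : Finset (EuclideanSpace ℝ (Fin d)), P.card = k →
      ∑ A, spread (fun i : Fin (n * (2 * k)) => gridPoint (2 * k) L i) a A ≤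
        4 * ∑ i : Fin (n * (2 * k)), sqDist P (gridPoint (2 * k) L i))
    (h : cost (gridPoint (2 * k) L) (n * (2 * k)) cs ≤ 8 * (1 + harmonic (k - 1)) *
      ∑ A, spread (fun i : Fin (n * (2 * k)) => gridPoint (2 * k) L i) a A)
    {P' : Finset (EuclideanSpace ℝ (Fin d))} (hP' : P'.card = k) :
    loss cs.toFinset L ≤ 20736 * (1 + Real.logb 2 k) * loss P' L := by
  have hM : (0 : ℝ) < (2 * k : ℕ) := by exact_mod_cast (by omega : 0 < 2 * k)
  have hne : ∀ {P : Finset (EuclideanSpace ℝ (Fin d))}, P.card = k → P.Nonempty := fun hP =>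
    Finset.card_pos.1 (by omega)
  have h1 := loss_le_gridLoss hk L (hne hcs) hcs.le
  have h2 := gridLoss_le_loss hk L (hne hP') hP'.le
  have h3 := ha P' hP'
  have hfin : ∑ i : Fin (n * (2 * k)), sqDist P' (gridPoint (2 * k) L i) = gridLoss k P' L := by
    rw [gridLoss_eq_sum, Finset.sum_range]
  have hcost : gridLoss k cs.toFinset L = cost (gridPoint (2 * k) L) (n * (2 * k)) cs := by
    rw [gridLoss_eq_sum, cost]
    congr!
  rw [hfin] at h3
  rw [hcost] at h1
  have hc := harmonic_cast_nonneg (k - 1)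
  have hh := one_add_harmonic_le hk
  set H : ℝ := 1 + harmonic (k - 1) with hH
  have hH0 : 0 ≤ H := by rw [hH]; linarith
  set ℓ := loss P' L
  have hℓ : 0 ≤ (2 * k : ℕ) * ℓ := by
    have : 0 ≤ gridLoss k P' L :=
      Finset.sum_nonneg fun i _ => Finset.sum_nonneg fun t _ => sqDist_nonneg _ _
    linarith
  refine le_of_mul_le_mul_left ?_ hM
  calc (2 * k : ℕ) * loss cs.toFinset L
      ≤ 18 * (8 * H * (4 * gridLoss k P' L)) := h1.trans (by gcongr; exact h.trans (by gcongr))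
    _ ≤ 18 * (8 * H * (4 * (18 * ((2 * k : ℕ) * ℓ)))) := by gcongr
    _ = 10368 * H * ((2 * k : ℕ) * ℓ) := by ring
    _ ≤ 10368 * (2 * (1 + Real.logb 2 k)) * ((2 * k : ℕ) * ℓ) := by gcongr
    _ = _ := by ring

open Classical in
lemma outputPoints_eq {cs : List (EuclideanSpace ℝ (Fin d))} {s : State} (hcs : cs.length = k)
    (h : Stored 2 cs s) : outputPoints d k s = cs.toFinset := by
  subst hcs
  have hpt : ∀ i : Fin cs.length,
      WithLp.toLp 2 (fun j : Fin d => s.realArr 2 ((i : ℕ) * d + j)) = cs[(i : ℕ)] := by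
    intro i
    ext j
    exact h i i.2 j j.2
  ext x
  simp only [outputPoints, Finset.mem_image, Finset.mem_univ, true_and, hpt, List.mem_toFinset]
  constructor
  · rintro ⟨i, rfl⟩
    exact List.getElem_mem _
  · intro hx
    obtain ⟨i, hi, rfl⟩ := List.getElem_of_mem hx
    exact ⟨⟨i, hi⟩, rfl⟩

/-- The number of trials. -/
lemma exists_trials {δ : ℝ} (hδ : δ ∈ Set.Ioc (0 : ℝ) (1 / 10)) :
    ∃ R : ℕ, 1 ≤ R ∧ (1 / 2 : ℝ) ^ R ≤ δ ∧ (∀ m < R, δ < (1 / 2 : ℝ) ^ m) ∧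
      (R : ℝ) ≤ 2 * Real.logb 2 (1 / δ) := by
  have h2 : (2 : ℝ) ≤ 1 / δ := by
    rw [le_div_iff₀ hδ.1]; linarith [hδ.2]
  have hpos : 0 < 1 / δ := by linarith
  have hlog : 1 ≤ Real.logb 2 (1 / δ) := by
    rw [Real.le_logb_iff_rpow_le (by norm_num) hpos]
    simpa using h2
  have hpow : ∀ m : ℕ, (1 / 2 : ℝ) ^ m ≤ δ ↔ Real.logb 2 (1 / δ) ≤ m := by
    intro m
    rw [Real.logb_le_iff_le_rpow (by norm_num) hpos, Real.rpow_natCast, one_div_pow,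
      one_div_le (by positivity) hδ.1]
  refine ⟨⌈Real.logb 2 (1 / δ)⌉₊, Nat.one_le_ceil_iff.2 (by linarith), (hpow _).2 (Nat.le_ceil _),
    fun m hm => ?_, ?_⟩
  · rw [← not_le, hpow, not_le]
    exact Nat.lt_ceil.1 hm
  · have := Nat.ceil_lt_add_one (by linarith : 0 ≤ Real.logb 2 (1 / δ))
    linarith

end Guarantee

end SegClust

end

/-! ### Running time, cardinality and success probability combined -/

theorem corollary1 :
    ∃ (prog : SegClust.Program) (A B : ℝ),
      ∀ (d n k : ℕ), 1 ≤ d → 1 ≤ n → 1 ≤ k →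
      ∀ (L : Fin n → SegClust.Segment d) (ε δ : ℝ),
        ε ∈ Set.Ioc (0 : ℝ) (1 / 10) → δ ∈ Set.Ioc (0 : ℝ) (1 / 10) →
        ∃ final : SegClust.Tape → SegClust.State,
          (∀ ω, ∃ t : ℕ,
            (t : ℝ) ≤ A * (d * n * k ^ 3 / ε * Real.logb 2 (1 / δ)) ∧
            SegClust.HaltsWithin ω prog (SegClust.inputState k L ε δ) t (final ω)) ∧
          (∀ ω, (SegClust.outputPoints d k (final ω)).card = k) ∧
          SegClust.tapeMeasure
            {ω | ¬ ∀ P' : Finset (EuclideanSpace ℝ (Fin d)), P'.card = k →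
              SegClust.loss (SegClust.outputPoints d k (final ω)) L ≤
                B * (1 + Real.logb 2 k) * SegClust.loss P' L} ≤ ENNReal.ofReal δ := by
  classical
  -- 2000 is the 1000 of `clusterProg_spec` times the 2 from R ≤ 2 log₂(1/δ).
  refine ⟨SegClust.clusterProg, 2000, 20736, fun d n k hd hn hk L ε δ hε hδ => ?_⟩
  obtain ⟨R, hR, hRδ, hmin, hRlog⟩ := SegClust.exists_trials hδ
  choose t ht final hrun hbest using fun ω : SegClust.Tape =>
    SegClust.clusterProg_spec (ω := ω) (L := L) hd hn hk ε hR hRδ hmin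
  have hN : 1 ≤ n * (2 * k) := Nat.mul_pos hn (by omega)
  have hcard : ∀ ω r, (SegClust.trialCentres k (n * (2 * k))
      (SegClust.gridPoint (2 * k) L) ω r).toFinset.card = k := fun ω r => by
    rw [List.toFinset_card_of_nodup, SegClust.length_trialCentres]
    exact SegClust.nodup_seeding _ _ _ (SegClust.fallback_notMem hd) _ _
  refine ⟨final, fun ω => ⟨t ω, ?_, (hrun ω).step_iterate []⟩, fun ω => ?_, ?_⟩
  · have h1 : (t ω : ℝ) ≤ 1000 * (d * n * k ^ 2 * R) := by exact_mod_cast ht ω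
    have hk1 : (1 : ℝ) ≤ k := by exact_mod_cast hk
    -- The actual bound has k² and no ε; the factors k and 1/ε are slack.
    have hk23 : (k : ℝ) ^ 2 ≤ k ^ 3 := pow_le_pow_right₀ hk1 (by norm_num)
    have h2 : (d * n * k ^ 3 : ℝ) ≤ d * n * k ^ 3 / ε := by
      rw [le_div_iff₀ hε.1]
      exact mul_le_of_le_one_right (by positivity) (by linarith [hε.2])
    have hlog : 0 ≤ Real.logb 2 (1 / δ) := by
      have : (0 : ℝ) ≤ R := Nat.cast_nonneg R
      linarith
    calc (t ω : ℝ) ≤ 1000 * (d * n * k ^ 2 * R) := h1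
      _ ≤ 1000 * (d * n * k ^ 3 * (2 * Real.logb 2 (1 / δ))) := by gcongr
      _ = 2000 * (d * n * k ^ 3 * Real.logb 2 (1 / δ)) := by ring
      _ ≤ _ := by gcongr
  · obtain ⟨r, -, hst, -⟩ := hbest ω
    rw [SegClust.outputPoints_eq (SegClust.length_trialCentres r) hst, hcard]
  · obtain ⟨a, ha⟩ := SegClust.exists_assignment_spread_le
      (fun i : Fin (n * (2 * k)) => SegClust.gridPoint (2 * k) L i) hk
    have hprob := SegClust.measure_all_trials_le (SegClust.gridPoint (2 * k) L) (n * (2 * k))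
      SegClust.fallback hk hN a R
    have hδR : (2⁻¹ : ENNReal) ^ R ≤ ENNReal.ofReal δ := by
      have h1 : (2⁻¹ : ENNReal) = ENNReal.ofReal (1 / 2) := by
        rw [one_div, ENNReal.ofReal_inv_of_pos (by norm_num), ENNReal.ofReal_ofNat]
      rw [h1, ← ENNReal.ofReal_pow (by norm_num)]
      exact ENNReal.ofReal_le_ofReal hRδ
    -- One cheap trial suffices, since the stored trial costs no more; so failure implies that all R
    -- trials were expensive.
    refine (MeasureTheory.measure_mono fun ω hω => ?_).trans (hprob.trans hδR)
    by_contra hnot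
    have hex : ∃ r < R, SegClust.cost (SegClust.gridPoint (2 * k) L) (n * (2 * k))
        (SegClust.trialCentres k (n * (2 * k)) (SegClust.gridPoint (2 * k) L) ω r) ≤
        8 * (1 + harmonic (k - 1)) *
          ∑ A, SegClust.spread (fun i : Fin (n * (2 * k)) => SegClust.gridPoint (2 * k) L i) a A := by
      by_contra hall
      push Not at hall
      exact hnot hall
    obtain ⟨r', hr', hle⟩ := hex
    obtain ⟨r, -, hst, -, hmin'⟩ := hbest ω
    refine hω fun P' hP' => ?_
    rw [SegClust.outputPoints_eq (SegClust.length_trialCentres r) hst]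
    exact SegClust.loss_le_of_cost_le hk L (hcard ω r) ha ((hmin' r' hr').trans hle) hP'
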